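/- Let $k$ be a field with algebraic closure $\bar k$. Let $\tilde G=SL_3$ and $G=\tilde G\rtimes\langle\sigma\rangle$, where $\sigma$ is the non-trivial graph automorphism $A\mapsto w\,(A^{T})^{-1}w^{-1}$ of $SL_3$, $w=\operatorname{antidiag}(1,-1,1)$; so $G^\circ=\tilde G$. Let $B$ be the Borel subgroup of upper triangular matrices of $SL_3$, regarded as a subgroup of $G$. For a cocharacter $\lambda$ of $G$ (over $\bar k$) let $P_\lambda$ be the group of all $g\in G$ such that $\lim_{a\to 0}\lambda(a)g\lambda(a)^{-1}$ exists, and $L_\lambda$ the group of all $g\in G$ for which this limit equals $g$. The groups $P_\lambda$ are the R-parabolic subgroups of $G$ (this includes $G$ itself), and $L_\lambda$ is called an R-Levi subgroup of $P_\lambda$. Let $\Lambda(G)$ be the set of $k$-defined R-parabolic subgroups of $G$, and for a closed subgroup $H$ of $G$ let $\Lambda(G)^H$ be the set of all $P\in\Lambda(G)$ containing $H$. The subgroup $H$ is $G$-completely reducible ($G$-cr) over $k$ if every $P\in\Lambda(G)^H$ has a $k$-defined R-Levi subgroup containing $H$. Let $\Delta(G)=\Delta(G^\circ)$ be the spherical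 building of $G$, whose simplices are the proper $k$-parabolic subgroups of $G^\circ=SL_3$. Then: 1. The subgroup $H=\langle\sigma,B\rangle$ of $G$ is a $k$-subgroup, it is not $G$-cr over $k$, and $\Lambda(G)^H\not\subseteq\Delta(G)$; indeed even $\Lambda(G)^H\setminus\{G\}\not\subseteq\Delta(G)$. 2. Exactly $5$ members of $\Lambda(G)$ contain $B$. Moreover, $\Lambda(G)$ ordered by reversed inclusion is not a simplicial complex, that is, it is not an ordered set in which the faces of each element (the elements below it) form an ordered set isomorphic to the set of all subsets of some set and any two elements have a greatest lower bound. -/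

import Mathlib

/-! ### Affine `k`-varieties, identified with their points over an algebraic closure `K` of `k`

An affine `k`-variety is given by its set `X` of `K`-points together with the `k`-algebra
`A` of its `k`-regular functions `X → K`. -/

section Varieties

variable {k K X Y : Type*} [Field k] [Field K] [Algebra k K]

/-- The algebra `K[X]` of all regular functions: the `K`-algebra generated by `k[X] = A`. -/
def regularFunctions (A : Subalgebra k (X → K)) : Subalgebra K (X → K) :=
  Algebra.adjoin K (A : Set (X → K))

/-- Morphisms of varieties over `K`: regular functions pull back to regular functions. -/
def IsMorphism (A : Subalgebra k (X → K)) (B : Subalgebra k (Y → K)) (φ : X → Y) : Prop :=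
  ∀ f ∈ regularFunctions B, f ∘ φ ∈ regularFunctions A

/-- Zariski-closed subsets: the zero loci of sets of regular functions. -/
def IsZariskiClosed (A : Subalgebra k (X → K)) (Z : Set X) : Prop :=
  ∃ S : Set (X → K), S ⊆ regularFunctions A ∧ Z = {x | ∀ f ∈ S, f x = 0}

/-- A closed subset `Z` is `k`-defined if its vanishing ideal in `K[X]` is spanned over `K` by the
elements of `k[X]` that vanish on `Z`. -/
def IsDefinedOver (A : Subalgebra k (X → K)) (Z : Set X) : Prop :=
  IsZariskiClosed A Z ∧
    ∀ f ∈ regularFunctions A, (∀ x ∈ Z, f x = 0) →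
      f ∈ Submodule.span K {h : X → K | h ∈ A ∧ ∀ x ∈ Z, h x = 0}

variable (k K) in
/-- The affine line: `k[t]` as functions on `K`. -/
def affineLine : Subalgebra k (K → K) :=
  Algebra.adjoin k {fun t : K => t}

variable (k K) in
/-- The multiplicative group: `k[t, t⁻¹]` as functions on `Kˣ`. -/
def multiplicativeGroup : Subalgebra k (Kˣ → K) :=
  Algebra.adjoin k {fun t : Kˣ => (t : K), fun t : Kˣ => ((t⁻¹ : Kˣ) : K)}

/-- `lim_{a → 0} φ(a)` exists and equals `x`: the map `φ` on `Kˣ` extends to a morphism from the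
affine line that takes the value `x` at `0`. -/
def HasLimitAtZero (A : Subalgebra k (X → K)) (φ : Kˣ → X) (x : X) : Prop :=
  ∃ ψ : K → X, IsMorphism (affineLine k K) A ψ ∧ (∀ a : Kˣ, ψ (a : K) = φ a) ∧ ψ 0 = x

end Varieties

/-! ### R-parabolic subgroups, R-Levi subgroups, complete reducibility over `k` -/

section Groups

variable {k K Γ : Type*} [Field k] [Field K] [Algebra k K] [Group Γ]

/-- Cocharacters (over `K`) of the algebraic group `Γ` with algebra `A` of `k`-regular functions. -/
def IsCocharacter (A : Subalgebra k (Γ → K)) (l : Kˣ →* Γ) : Prop :=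
  IsMorphism (multiplicativeGroup k K) A l

/-- `P_λ`: the elements `g` for which `lim_{a → 0} λ(a) g λ(a)⁻¹` exists. -/
def parabolicSet (A : Subalgebra k (Γ → K)) (l : Kˣ →* Γ) : Set Γ :=
  {g | ∃ x, HasLimitAtZero A (fun a => l a * g * (l a)⁻¹) x}

/-- `L_λ`: the elements `g` for which `lim_{a → 0} λ(a) g λ(a)⁻¹ = g`. -/
def leviSet (A : Subalgebra k (Γ → K)) (l : Kˣ →* Γ) : Set Γ :=
  {g | HasLimitAtZero A (fun a => l a * g * (l a)⁻¹) g}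

/-- `P` is an R-parabolic subgroup, that is `P = P_λ` for some cocharacter `λ`. -/
def IsRParabolic (A : Subalgebra k (Γ → K)) (P : Subgroup Γ) : Prop :=
  ∃ l : Kˣ →* Γ, IsCocharacter A l ∧ (P : Set Γ) = parabolicSet A l

/-- `L` is an R-Levi subgroup of `P`, that is `P = P_λ` and `L = L_λ` for some cocharacter `λ`. -/
def IsRLevi (A : Subalgebra k (Γ → K)) (P L : Subgroup Γ) : Prop :=
  ∃ l : Kˣ →* Γ, IsCocharacter A l ∧ (P : Set Γ) = parabolicSet A l ∧ (L : Set Γ) = leviSet A l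

/-- `Λ(Γ)`: the set of `k`-defined R-parabolic subgroups (including `Γ` itself). -/
def kRParabolics (A : Subalgebra k (Γ → K)) : Set (Subgroup Γ) :=
  {P | IsRParabolic A P ∧ IsDefinedOver A (P : Set Γ)}

/-- `Λ(Γ)^H`: the `k`-defined R-parabolic subgroups containing `H`. -/
def kRParabolicsOver (A : Subalgebra k (Γ → K)) (H : Subgroup Γ) : Set (Subgroup Γ) :=
  {P | P ∈ kRParabolics A ∧ H ≤ P}

/-- `H` is `Γ`-completely reducible over `k`: every `k`-defined R-parabolic subgroup `P`
containing `H` has a `k`-defined R-Levi subgroup containing `H`. -/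
def IsCompletelyReducibleOver (A : Subalgebra k (Γ → K)) (H : Subgroup Γ) : Prop :=
  ∀ P ∈ kRParabolics A, H ≤ P →
    ∃ L : Subgroup Γ, IsRLevi A P L ∧ IsDefinedOver A (L : Set Γ) ∧ H ≤ L

end Groups

/-- Simplicial complexes as ordered sets (`a ≤ b` means that `a` is a face of `b`; the empty
simplex is included): the faces of each element form an ordered set isomorphic to the set of all
subsets of some set, and any two elements have a greatest lower bound. -/
def IsSimplicialComplex.{u} (X : Type u) [PartialOrder X] : Prop :=
  (∀ a : X, ∃ V : Type u, Nonempty (Set.Iic a ≃o Set V)) ∧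
    ∀ a b : X, ∃ c : X, IsGLB {a, b} c

/-! ### The group `SL₃ ⋊ ⟨σ⟩` -/

section GraphAutomorphism

open Matrix

variable (k K : Type*) [Field k] [Field K] [Algebra k K]

/-- The representative `antidiag(1, -1, 1)` of the longest element of the Weyl group. -/
def longestElement : Matrix.SpecialLinearGroup (Fin 3) K :=
  ⟨!![0, 0, 1; 0, -1, 0; 1, 0, 0], by simp [det_fin_three]⟩

theorem coe_longestElement :
    (longestElement K : Matrix (Fin 3) (Fin 3) K) = !![0, 0, 1; 0, -1, 0; 1, 0, 0] := rfl

/-- The map `A ↦ w (Aᵀ)⁻¹ w⁻¹`, where `w = antidiag(1, -1, 1)`. -/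
def graphMap (A : Matrix.SpecialLinearGroup (Fin 3) K) : Matrix.SpecialLinearGroup (Fin 3) K :=
  longestElement K * (A.transpose)⁻¹ * (longestElement K)⁻¹

variable {K} in
theorem graphMap_mul (A B : Matrix.SpecialLinearGroup (Fin 3) K) :
    graphMap K (A * B) = graphMap K A * graphMap K B := by
  have h : (A * B).transpose = B.transpose * A.transpose := by
    ext i j
    simp [Matrix.mul_apply, mul_comm]
  simp [graphMap, h, mul_assoc]

variable {K} in
theorem graphMap_graphMap (A : Matrix.SpecialLinearGroup (Fin 3) K) :
    graphMap K (graphMap K A) = A := by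
  have hmul : ∀ X Y : Matrix.SpecialLinearGroup (Fin 3) K,
      (X * Y).transpose = Y.transpose * X.transpose := by
    intro X Y
    ext i j
    simp [Matrix.mul_apply, mul_comm]
  have hinv : ∀ X : Matrix.SpecialLinearGroup (Fin 3) K, (X⁻¹).transpose = (X.transpose)⁻¹ := by
    intro X
    rw [eq_inv_iff_mul_eq_one, ← hmul, mul_inv_cancel]
    ext i j
    simp [Matrix.one_apply, eq_comm]
  have hw : (longestElement K).transpose = longestElement K := by
    ext i j
    rw [Matrix.SpecialLinearGroup.coe_transpose, coe_longestElement]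
    fin_cases i <;> fin_cases j <;> simp
  have hww : longestElement K * longestElement K = 1 := by
    apply Matrix.SpecialLinearGroup.ext
    intro i j
    rw [Matrix.SpecialLinearGroup.coe_mul, coe_longestElement]
    fin_cases i <;> fin_cases j <;> simp [Matrix.mul_apply, Fin.sum_univ_three]
  have hw' : (longestElement K)⁻¹ = longestElement K := inv_eq_of_mul_eq_one_left hww
  have htt : A.transpose.transpose = A := by
    ext i j
    simp
  simp only [graphMap, hmul, hinv, hw, hw', htt, _root_.mul_inv_rev, inv_inv]
  have hww' : ∀ X : Matrix.SpecialLinearGroup (Fin 3) K, longestElement K * (longestElement K * X) = X := by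
    intro X
    rw [← mul_assoc, hww, one_mul]
  simp only [mul_assoc, hww, hww', mul_one]

/-- The non-trivial graph automorphism `σ` of `SL₃` (it preserves the diagonal torus and the upper
triangular Borel subgroup, interchanges the two simple roots, and preserves the standard pinning). -/
def graphAutomorphism : MulAut (Matrix.SpecialLinearGroup (Fin 3) K) where
  toFun := graphMap K
  invFun := graphMap K
  left_inv := graphMap_graphMap
  right_inv := graphMap_graphMap
  map_mul' := graphMap_mul

/-- `G = SL₃ ⋊ ⟨σ⟩` (its `K`-points). -/
abbrev ExtendedSL3 : Type _ :=
  Matrix.SpecialLinearGroup (Fin 3) K ⋊[(Subgroup.zpowers (graphAutomorphism K)).subtype]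
    (Subgroup.zpowers (graphAutomorphism K))

/-- `σ` as an element of `G`. -/
def sigma : ExtendedSL3 K :=
  SemidirectProduct.inr ⟨graphAutomorphism K, Subgroup.mem_zpowers _⟩

/-- `k[SL₃]`: generated by the matrix entries. -/
def coordinateRingSL3 : Subalgebra k (Matrix.SpecialLinearGroup (Fin 3) K → K) :=
  Algebra.adjoin k {f | ∃ i j : Fin 3,
    f = fun g : Matrix.SpecialLinearGroup (Fin 3) K => (g : Matrix (Fin 3) (Fin 3) K) i j}

open Classical in
/-- `k[G]`: as a variety, `G` is the product of `SL₃` with the finite constant group `⟨σ⟩`; its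
coordinate ring is generated by the matrix entries and the indicator functions of the
elements of `⟨σ⟩`. -/
noncomputable def coordinateRing : Subalgebra k (ExtendedSL3 K → K) :=
  Algebra.adjoin k
    ({f | ∃ i j : Fin 3,
        f = fun g : ExtendedSL3 K => (g.left : Matrix (Fin 3) (Fin 3) K) i j} ∪
      {f | ∃ s : Subgroup.zpowers (graphAutomorphism K),
        f = fun g : ExtendedSL3 K => if g.right = s then 1 else 0})

/-- The Borel subgroup of upper triangular matrices in `SL₃`. -/
def borelSL3 : Subgroup (Matrix.SpecialLinearGroup (Fin 3) K) where
  carrier := {g | ∀ i j : Fin 3, j < i → (g : Matrix (Fin 3) (Fin 3) K) i j = 0}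
  one_mem' := by
    intro i j h
    simp [h.ne']
  mul_mem' := by
    intro a b ha hb
    have ha' : (a : Matrix (Fin 3) (Fin 3) K).BlockTriangular id := fun i j h => ha i j h
    have hb' : (b : Matrix (Fin 3) (Fin 3) K).BlockTriangular id := fun i j h => hb i j h
    intro i j h
    exact (ha'.mul hb') h
  inv_mem' := by
    intro a ha
    have h10 := ha 1 0 (by decide)
    have h20 := ha 2 0 (by decide)
    have h21 := ha 2 1 (by decide)
    intro i j h
    fin_cases i <;> fin_cases j <;>
      simp_all [adjugate_fin_three]

/-- The Borel subgroup `B` as a subgroup of `G`. -/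
def borelSubgroup : Subgroup (ExtendedSL3 K) :=
  (borelSL3 K).map SemidirectProduct.inl

/-- The simplices of the spherical building `Δ(G) = Δ(G°)`, `G° = SL₃`: the proper `k`-parabolic
subgroups of `SL₃` (for this connected group the same as the `k`-defined R-parabolic ones),
regarded as subgroups of `G`. -/
def building : Set (Subgroup (ExtendedSL3 K)) :=
  {P | ∃ Q ∈ kRParabolics (coordinateRingSL3 k K), Q ≠ ⊤ ∧ P = Q.map SemidirectProduct.inl}

end GraphAutomorphism

/-!
A cocharacter of `G` takes its values in `SL₃`, since `Kˣ` has no nonconstant regular function of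
finite range. By the Bruhat decomposition the subgroups of `G` containing `B` are `B`, the two
maximal parabolic subgroups of `SL₃` (which `σ` interchanges), `SL₃`, `B ⋊ ⟨σ⟩` and `G`. Among them
only `SL₃` is not R-parabolic: `P_λ ⊇ SL₃` forces `λ` to be central, hence trivial, and then
`P_λ = G`. The others are `P_λ` for diagonal `λ`, where a diagonal `λ` of weights `(n₁, n₂, n₃)` has
a `P_λ` that meets the coset of `σ` only if the weights are symmetric about `0`, as for
`(1, 0, -1)`, which gives `B ⋊ ⟨σ⟩`. So five R-parabolic subgroups contain `B`; since `5` is not a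
power of `2`, they cannot be the faces of a simplex. Finally an R-Levi subgroup containing `B` is
centralized by `λ`, so `λ` is again trivial; hence `B ⋊ ⟨σ⟩`, which is itself R-parabolic, lies in
none of its own R-Levi subgroups.

The groups in question are `k`-defined because they are unions of images of principal open subsets
of affine spaces over `k`, on which linear disjointness of `K` and the `k`-regular functions can be
checked on coefficients.
-/

section Morphisms

variable {k K X Y Z : Type*} [Field k] [Field K] [Algebra k K]
  {A : Subalgebra k (X → K)} {B : Subalgebra k (Y → K)} {C : Subalgebra k (Z → K)}

theorem regularFunctions_adjoin (S : Set (X → K)) :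
    regularFunctions (Algebra.adjoin k S) = Algebra.adjoin K S :=
  Algebra.adjoin_adjoin_of_tower k S

theorem mem_regularFunctions_of_mem {f : X → K} (hf : f ∈ A) : f ∈ regularFunctions A :=
  Algebra.subset_adjoin hf

theorem isMorphism_adjoin {S : Set (Y → K)} {φ : X → Y}
    (h : ∀ f ∈ S, f ∘ φ ∈ regularFunctions A) : IsMorphism A (Algebra.adjoin k S) φ := by
  intro f hf
  rw [regularFunctions_adjoin] at hf
  induction hf using Algebra.adjoin_induction with
  | mem f hf => exact h f hf
  | algebraMap c => exact (regularFunctions A).algebraMap_mem c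
  | add f g _ _ hf hg => exact add_mem hf hg
  | mul f g _ _ hf hg => exact mul_mem hf hg

theorem IsMorphism.comp {ψ : Y → Z} {φ : X → Y} (hψ : IsMorphism B C ψ) (hφ : IsMorphism A B φ) :
    IsMorphism A C (ψ ∘ φ) :=
  fun f hf => hφ _ (hψ f hf)

theorem isMorphism_const (y : Y) : IsMorphism A B fun _ => y :=
  fun f _ => (regularFunctions A).algebraMap_mem (f y)

theorem isDefinedOver_univ (A : Subalgebra k (X → K)) : IsDefinedOver A Set.univ := by
  refine ⟨⟨∅, by simp, by simp⟩, fun f _ h => ?_⟩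
  rw [show f = 0 from funext fun x => h x trivial]
  exact zero_mem _

end Morphisms

section PolynomialFunctions

open Polynomial

variable {k K : Type*} [Field k] [Field K] [Algebra k K]

theorem mem_regularFunctions_affineLine {f : K → K} :
    f ∈ regularFunctions (affineLine k K) ↔ ∃ p : K[X], ∀ a, p.eval a = f a := by
  rw [affineLine, regularFunctions_adjoin, Algebra.adjoin_singleton_eq_range_aeval]
  simp [funext_iff, aeval_fn_apply]

theorem isMorphism_affineLine_mul_left (c : K) :
    IsMorphism (affineLine k K) (affineLine k K) (c * ·) := by
  refine isMorphism_adjoin ?_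
  rintro _ rfl
  exact mem_regularFunctions_affineLine.2 ⟨Polynomial.C c * X, fun a => by simp⟩

theorem eq_of_forall_eval_units_eq [Infinite K] {p q : K[X]}
    (h : ∀ a : Kˣ, p.eval (a : K) = q.eval (a : K)) : p = q := by
  refine mul_right_cancel₀ X_ne_zero (Polynomial.funext fun a => ?_ : p * X = q * X)
  rcases eq_or_ne a 0 with rfl | ha
  · simp
  · simpa using Or.inl (h (Units.mk0 a ha))

variable (K) in
/-- The functions on `Kˣ` given by polynomials, that is, those which extend to regular functions on
the affine line. A limit at `0` exists coordinatewise in this algebra. -/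
noncomputable def polynomialUnitFunctions : Subalgebra K (Kˣ → K) :=
  (aeval fun a : Kˣ => (a : K)).range

theorem mem_polynomialUnitFunctions {f : Kˣ → K} :
    f ∈ polynomialUnitFunctions K ↔ ∃ p : K[X], ∀ a : Kˣ, p.eval (a : K) = f a := by
  simp [polynomialUnitFunctions, funext_iff, aeval_fn_apply]

theorem zpow_mul_const_mem_polynomialUnitFunctions_iff [Infinite K] (d : ℤ) (c : K) :
    (fun a : Kˣ => ((a ^ d : Kˣ) : K) * c) ∈ polynomialUnitFunctions K ↔ 0 ≤ d ∨ c = 0 := by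
  refine mem_polynomialUnitFunctions.trans ⟨fun ⟨p, hp⟩ => ?_, ?_⟩
  · by_contra! ⟨hd, hc⟩
    obtain ⟨m, hm, rfl⟩ := Int.exists_eq_neg_ofNat hd.le
    have hX : p * X ^ m = C c := eq_of_forall_eval_units_eq fun a => by
      simp only [eval_mul, hp, zpow_neg, zpow_natCast, eval_pow, eval_X, eval_C,
        Units.val_inv_eq_inv_val, Units.val_pow_eq_pow_val]
      field_simp
    have h0 := congrArg (eval 0) hX
    simp only [eval_mul, eval_pow, eval_X, eval_C] at h0
    rw [zero_pow (by omega), mul_zero] at h0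
    exact hc h0.symm
  · rintro (hd | rfl)
    · lift d to ℕ using hd
      exact ⟨C c * X ^ d, fun a => by simpa using mul_comm _ _⟩
    · exact ⟨0, by simp⟩

theorem eq_apply_one_of_mem_polynomialUnitFunctions [Infinite K] {f : Kˣ → K}
    (hf : f ∈ polynomialUnitFunctions K)
    (hf' : (fun a => f a⁻¹) ∈ polynomialUnitFunctions K) (a : Kˣ) : f a = f 1 := by
  obtain ⟨p, hp⟩ := mem_polynomialUnitFunctions.1 hf
  obtain ⟨q, hq⟩ := mem_polynomialUnitFunctions.1 hf'
  have hreverse : p.reverse = q * X ^ p.natDegree := eq_of_forall_eval_units_eq fun b => by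
    let _ : Invertible ((b⁻¹ : Kˣ) : K) := (b⁻¹).invertible
    have h := eval₂_reverse_mul_pow (RingHom.id K) ((b⁻¹ : Kˣ) : K) p
    rw [invOf_eq_inv, ← Units.val_inv_eq_inv_val, inv_inv, eval₂_id, eval₂_id, hp, ← hq] at h
    rw [eval_mul, ← h, eval_pow, eval_X, mul_assoc, ← mul_pow, Units.inv_mul, one_pow, mul_one]
  have hdegree : q.natDegree = 0 := by
    rcases eq_or_ne q 0 with rfl | hq0
    · exact natDegree_zero
    · have h := reverse_natDegree_le p
      rw [hreverse, natDegree_mul hq0 (pow_ne_zero _ X_ne_zero), natDegree_X_pow] at h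
      omega
  rw [← inv_inv a, ← hq a⁻¹, show f 1 = f 1⁻¹ by rw [inv_one], ← hq 1,
    eq_C_of_natDegree_eq_zero hdegree, eval_C, eval_C]

theorem zpow_mem_regularFunctions_multiplicativeGroup (d : ℤ) :
    (fun a : Kˣ => ((a ^ d : Kˣ) : K)) ∈ regularFunctions (multiplicativeGroup k K) := by
  rw [multiplicativeGroup, regularFunctions_adjoin]
  obtain ⟨m, rfl | rfl⟩ := d.eq_nat_or_neg
  · convert pow_mem (Algebra.subset_adjoin (Set.mem_insert (fun a : Kˣ => (a : K)) _)) m using 1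
    simp [funext_iff]
  · convert pow_mem (Algebra.subset_adjoin (Set.mem_insert_of_mem (fun a : Kˣ => (a : K))
      (Set.mem_singleton fun a : Kˣ => ((a⁻¹ : Kˣ) : K)))) m using 1
    simp [funext_iff]

theorem exists_mul_pow_mem_polynomialUnitFunctions {f : Kˣ → K}
    (hf : f ∈ regularFunctions (multiplicativeGroup k K)) :
    ∃ n : ℕ, f * (fun a : Kˣ => (a : K)) ^ n ∈ polynomialUnitFunctions K := by
  have hX : (fun a : Kˣ => (a : K)) ∈ polynomialUnitFunctions K :=
    mem_polynomialUnitFunctions.2 ⟨X, by simp⟩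
  rw [multiplicativeGroup, regularFunctions_adjoin] at hf
  induction hf using Algebra.adjoin_induction with
  | mem f hf =>
    obtain rfl | rfl := hf
    · exact ⟨0, by simp [hX]⟩
    · refine ⟨1, ?_⟩
      convert one_mem (polynomialUnitFunctions K)
      simp [funext_iff]
  | algebraMap c => exact ⟨0, by simp⟩
  | add f g _ _ hf hg =>
    obtain ⟨m, hm⟩ := hf
    obtain ⟨n, hn⟩ := hg
    refine ⟨m + n, ?_⟩
    convert add_mem (mul_mem hm (pow_mem hX n)) (mul_mem hn (pow_mem hX m)) using 1
    ring
  | mul f g _ _ hf hg =>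
    obtain ⟨m, hm⟩ := hf
    obtain ⟨n, hn⟩ := hg
    refine ⟨m + n, ?_⟩
    convert mul_mem hm hn using 1
    ring

theorem eq_apply_one_of_finite_range [Infinite K] {f : Kˣ → K}
    (hf : f ∈ regularFunctions (multiplicativeGroup k K)) (hfin : (Set.range f).Finite)
    (a : Kˣ) : f a = f 1 := by
  obtain ⟨n, hn⟩ := exists_mul_pow_mem_polynomialUnitFunctions hf
  obtain ⟨p, hp⟩ := mem_polynomialUnitFunctions.1 hn
  have hprod : ∏ s ∈ hfin.toFinset, (p - C s * X ^ n) = 0 := by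
    refine eq_of_forall_eval_units_eq fun b => ?_
    rw [eval_prod, eval_zero]
    exact Finset.prod_eq_zero (i := f b) (by simp) (by simp [hp])
  obtain ⟨s, -, hs⟩ := Finset.prod_eq_zero_iff.1 hprod
  have hconst (b : Kˣ) : f b = s := by
    have h : f b * (b : K) ^ n = s * (b : K) ^ n := by
      simpa [hp] using congrArg (eval (b : K)) (sub_eq_zero.1 hs)
    exact mul_right_cancel₀ (pow_ne_zero n b.ne_zero) h
  rw [hconst, hconst]

end PolynomialFunctions

section Limits

variable {k K X Y : Type*} [Field k] [Field K] [Algebra k K]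
  {A : Subalgebra k (X → K)} {B : Subalgebra k (Y → K)} {φ : Kˣ → X} {x y : X}

theorem HasLimitAtZero.map {ρ : X → Y} (hρ : IsMorphism A B ρ) (h : HasLimitAtZero A φ x) :
    HasLimitAtZero B (fun a => ρ (φ a)) (ρ x) := by
  obtain ⟨ψ, hψ, hψφ, hψ0⟩ := h
  exact ⟨ρ ∘ ψ, hρ.comp hψ, fun a => congrArg ρ (hψφ a), congrArg ρ hψ0⟩

theorem HasLimitAtZero.comp_mul_left (h : HasLimitAtZero A φ x) (c : Kˣ) :
    HasLimitAtZero A (fun a => φ (c * a)) x := by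
  obtain ⟨ψ, hψ, hψφ, hψ0⟩ := h
  exact ⟨ψ ∘ ((c : K) * ·), hψ.comp (isMorphism_affineLine_mul_left _),
    fun a => hψφ (c * a), by simpa using hψ0⟩

theorem hasLimitAtZero_const (x : X) : HasLimitAtZero A (fun _ => x) x :=
  ⟨fun _ => x, isMorphism_const x, fun _ => rfl, rfl⟩

theorem HasLimitAtZero.exists_polynomial (h : HasLimitAtZero A φ x) {f : X → K}
    (hf : f ∈ regularFunctions A) :
    ∃ p : Polynomial K, (∀ a : Kˣ, p.eval (a : K) = f (φ a)) ∧ p.eval 0 = f x := by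
  obtain ⟨ψ, hψ, hψφ, rfl⟩ := h
  obtain ⟨p, hp⟩ := mem_regularFunctions_affineLine.1 (hψ f hf)
  exact ⟨p, fun a => by rw [hp, Function.comp_apply, hψφ], hp 0⟩

theorem HasLimitAtZero.comp_mem_polynomialUnitFunctions (h : HasLimitAtZero A φ x) {f : X → K}
    (hf : f ∈ regularFunctions A) : (fun a => f (φ a)) ∈ polynomialUnitFunctions K :=
  let ⟨p, hp, _⟩ := h.exists_polynomial hf
  mem_polynomialUnitFunctions.2 ⟨p, hp⟩

theorem HasLimitAtZero.unique [Infinite K] (hA : (A : Set (X → K)).SeparatesPoints)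
    (hx : HasLimitAtZero A φ x) (hy : HasLimitAtZero A φ y) : x = y := by
  by_contra hxy
  obtain ⟨f, hf, hfxy⟩ := hA hxy
  obtain ⟨p, hp, hp0⟩ := hx.exists_polynomial (mem_regularFunctions_of_mem hf)
  obtain ⟨q, hq, hq0⟩ := hy.exists_polynomial (mem_regularFunctions_of_mem hf)
  have hpq : p = q := eq_of_forall_eval_units_eq fun a => (hp a).trans (hq a).symm
  exact hfxy (by rw [← hp0, ← hq0, hpq])

end Limits

section Cocharacters

variable {k K Γ : Type*} [Field k] [Field K] [Algebra k K] [Group Γ] {A : Subalgebra k (Γ → K)}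

theorem parabolicSet_one : parabolicSet A 1 = Set.univ :=
  Set.eq_univ_of_forall fun g => ⟨g, by simpa using hasLimitAtZero_const g⟩

theorem isRParabolic_top : IsRParabolic A ⊤ :=
  ⟨1, isMorphism_const 1, by rw [parabolicSet_one, Subgroup.coe_top]⟩

theorem IsCocharacter.eq_one_of_finite_range [Infinite K]
    (hA : (A : Set (Γ → K)).SeparatesPoints) {l : Kˣ →* Γ} (hl : IsCocharacter A l)
    (hfin : (Set.range l).Finite) : l = 1 := by
  ext a
  by_contra hla
  obtain ⟨f, hf, hfa⟩ := hA hla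
  refine hfa ?_
  rw [MonoidHom.one_apply, ← map_one l]
  exact eq_apply_one_of_finite_range (hl f (mem_regularFunctions_of_mem hf))
    ((hfin.image f).subset (Set.range_comp f l).subset) a

-- The limit of `b ↦ λ(ab) g λ(ab)⁻¹` is `g` by reparametrization and `λ(a) g λ(a)⁻¹` by continuity.
theorem commute_of_mem_leviSet [Infinite K] (hA : (A : Set (Γ → K)).SeparatesPoints)
    {l : Kˣ →* Γ} (hconj : ∀ a, IsMorphism A A fun g => l a * g * (l a)⁻¹) {g : Γ}
    (hg : g ∈ leviSet A l) (a : Kˣ) : Commute (l a) g := by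
  have hlim : HasLimitAtZero A (fun b => l b * g * (l b)⁻¹) g := hg
  have hmap := hlim.map (hconj a)
  have hcomp := hlim.comp_mul_left a
  simp only [map_mul, mul_inv_rev, ← mul_assoc] at hmap hcomp
  exact mul_inv_eq_iff_eq_mul.1 (hmap.unique hA hcomp)

end Cocharacters

section FieldsOfDefinition

open MvPolynomial

variable {k K X Y : Type*} [Field k] [Field K] [Algebra k K]
  {A : Subalgebra k (X → K)} {B : Subalgebra k (Y → K)} {Z : Set X}

/-- Linear independence over `k` of elements of `K` persists over the restrictions to `Z` of the
`k`-regular functions: `K` and `k[X]|_Z` are linearly disjoint over `k`. For closed `Z` this is a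
criterion for `Z` to be `k`-defined. -/
def IsLinearlyDisjointOn (A : Subalgebra k (X → K)) (Z : Set X) : Prop :=
  ∀ ⦃r : ℕ⦄ ⦃c : Fin r → K⦄, LinearIndependent k c → ∀ ⦃g : Fin r → X → K⦄, (∀ j, g j ∈ A) →
    (∀ z ∈ Z, ∑ j, c j * g j z = 0) → ∀ j, ∀ z ∈ Z, g j z = 0

theorem IsLinearlyDisjointOn.iUnion {ι : Sort*} {Z : ι → Set X}
    (h : ∀ i, IsLinearlyDisjointOn A (Z i)) : IsLinearlyDisjointOn A (⋃ i, Z i) := by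
  intro r c hc g hg hsum j z hz
  obtain ⟨i, hi⟩ := Set.mem_iUnion.1 hz
  exact h i hc hg (fun z hz => hsum z (Set.mem_iUnion_of_mem i hz)) j z hi

theorem IsLinearlyDisjointOn.range (h : IsLinearlyDisjointOn A Set.univ) {φ : X → Y}
    (hφ : ∀ f ∈ B, f ∘ φ ∈ A) : IsLinearlyDisjointOn B (Set.range φ) := by
  rintro r c hc g hg hsum j _ ⟨x, rfl⟩
  exact h hc (fun j => hφ _ (hg j)) (fun x _ => hsum (φ x) ⟨x, rfl⟩) j x trivial

theorem exists_eq_sum_smul_of_mem_regularFunctions {f : X → K} (hf : f ∈ regularFunctions A) :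
    ∃ (r : ℕ) (c : Fin r → K) (g : Fin r → X → K),
      LinearIndependent k c ∧ (∀ j, g j ∈ A) ∧ f = ∑ j, c j • g j := by
  have hspan : f ∈ Submodule.span K (A : Set (X → K)) := by
    have hclosure : (Submonoid.closure (A : Set (X → K)) : Set (X → K)) = A :=
      congrArg SetLike.coe (Submonoid.closure_eq A.toSubmonoid)
    rwa [← hclosure, ← Algebra.adjoin_eq_span]
  obtain ⟨n, d, a, rfl⟩ := Submodule.mem_span_set'.1 hspan
  have : FiniteDimensional k (Submodule.span k (Set.range d)) :=
    FiniteDimensional.span_of_finite k (Set.finite_range d)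
  let b := Module.finBasis k (Submodule.span k (Set.range d))
  let d' (i : Fin n) : Submodule.span k (Set.range d) := ⟨d i, Submodule.subset_span ⟨i, rfl⟩⟩
  refine ⟨_, fun j => b j, fun j => ∑ i, b.repr (d' i) j • (a i : X → K),
    b.linearIndependent.map' (Submodule.subtype _) (Submodule.ker_subtype _),
    fun j => sum_mem fun i _ => A.smul_mem (a i).2 _, ?_⟩
  have hd (i : Fin n) : d i = ∑ j, b.repr (d' i) j • (b j : K) := by
    simpa only [Submodule.coe_sum, Submodule.coe_smul] using
      congrArg Subtype.val (b.sum_repr (d' i)).symm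
  simp_rw [Finset.smul_sum]
  rw [Finset.sum_comm]
  refine Finset.sum_congr rfl fun i _ => ?_
  rw [hd i, Finset.sum_smul]
  exact Finset.sum_congr rfl fun j _ => by rw [smul_assoc, smul_comm]

theorem IsLinearlyDisjointOn.isDefinedOver (h : IsLinearlyDisjointOn A Z)
    (hZ : IsZariskiClosed A Z) : IsDefinedOver A Z := by
  refine ⟨hZ, fun f hf hfZ => ?_⟩
  obtain ⟨r, c, g, hc, hg, rfl⟩ := exists_eq_sum_smul_of_mem_regularFunctions hf
  refine sum_mem fun j _ => Submodule.smul_mem _ _ (Submodule.subset_span ⟨hg j, ?_⟩)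
  exact h hc hg (fun z hz => by simpa using hfZ z hz) j

end FieldsOfDefinition

section PrincipalOpen

open MvPolynomial

variable {k K τ : Type*} [Field k] [Field K] [Algebra k K]

variable (K) in
/-- The coordinate ring `k[τ][1/q]` of the principal open subset `q ≠ 0` of an affine space, as an
algebra of functions on the `K`-points. -/
noncomputable def principalOpen (q : MvPolynomial τ k) :
    Subalgebra k ({x : τ → K // aeval x q ≠ 0} → K) :=
  Algebra.adjoin k (insert (fun x => (aeval x.1 q)⁻¹) (Set.range fun i x => x.1 i))

theorem exists_polynomial_of_mem_principalOpen {q : MvPolynomial τ k}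
    {f : {x : τ → K // aeval x q ≠ 0} → K} (hf : f ∈ principalOpen K q) :
    ∃ (n : ℕ) (p : MvPolynomial τ k), ∀ x, f x * aeval x.1 q ^ n = aeval x.1 p := by
  induction hf using Algebra.adjoin_induction with
  | mem f hf =>
    obtain rfl | ⟨i, rfl⟩ := hf
    · exact ⟨1, 1, fun x => by simp [inv_mul_cancel₀ x.2]⟩
    · exact ⟨0, X i, fun x => by simp⟩
  | algebraMap c => exact ⟨0, C c, fun x => by simp⟩
  | add f g _ _ hf hg =>
    obtain ⟨n, p, hp⟩ := hf
    obtain ⟨m, r, hr⟩ := hg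
    refine ⟨n + m, p * q ^ m + r * q ^ n, fun x => ?_⟩
    simp only [Pi.add_apply, map_add, map_mul, map_pow, ← hp, ← hr]
    ring
  | mul f g _ _ hf hg =>
    obtain ⟨n, p, hp⟩ := hf
    obtain ⟨m, r, hr⟩ := hg
    refine ⟨n + m, p * r, fun x => ?_⟩
    simp only [Pi.mul_apply, map_mul, ← hp, ← hr]
    ring

theorem exists_common_denominator {ι : Type*} [Finite ι] {q : MvPolynomial τ k}
    {g : ι → {x : τ → K // aeval x q ≠ 0} → K} (hg : ∀ j, g j ∈ principalOpen K q) :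
    ∃ (N : ℕ) (p : ι → MvPolynomial τ k), ∀ j x, g j x * aeval x.1 q ^ N = aeval x.1 (p j) := by
  cases nonempty_fintype ι
  choose n p hp using fun j => exists_polynomial_of_mem_principalOpen (hg j)
  refine ⟨∑ j, n j, fun j => p j * q ^ (∑ j, n j - n j), fun j x => ?_⟩
  have hle : n j ≤ ∑ j, n j := Finset.single_le_sum (fun _ _ => Nat.zero_le _) (Finset.mem_univ j)
  rw [map_mul, ← hp, map_pow, mul_assoc, ← pow_add, Nat.add_sub_cancel' hle]

theorem eq_zero_of_sum_C_mul_map_eq_zero {ι : Type*} [Fintype ι] {c : ι → K}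
    (hc : LinearIndependent k c) {p : ι → MvPolynomial τ k}
    (h : ∑ j, C (c j) * map (algebraMap k K) (p j) = 0) (j : ι) : p j = 0 := by
  ext m
  refine Fintype.linearIndependent_iff.1 hc (fun j => coeff m (p j)) ?_ j
  simpa [coeff_sum, coeff_C_mul, coeff_map, Algebra.smul_def, mul_comm]
    using congrArg (coeff m) h

theorem eq_zero_of_forall_eval_eq_zero [Infinite K] {p q : MvPolynomial τ K} (hq : q ≠ 0)
    (h : ∀ x, eval x q ≠ 0 → eval x p = 0) : p = 0 := by
  refine (mul_eq_zero.1 (MvPolynomial.funext fun x => ?_ : p * q = 0)).resolve_right hq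
  rw [map_mul, map_zero, mul_eq_zero]
  exact or_iff_not_imp_right.2 (h x)

theorem isLinearlyDisjointOn_principalOpen [Infinite K] {q : MvPolynomial τ k} (hq : q ≠ 0) :
    IsLinearlyDisjointOn (principalOpen K q) Set.univ := by
  intro r c hc g hg hsum j x _
  obtain ⟨N, p, hp⟩ := exists_common_denominator hg
  have hqK : map (algebraMap k K) q ≠ 0 :=
    (map_ne_zero_iff _ (map_injective _ (algebraMap k K).injective)).2 hq
  have hsum_map : ∑ j, C (c j) * map (algebraMap k K) (p j) = 0 := by
    refine eq_zero_of_forall_eval_eq_zero hqK fun y hy => ?_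
    rw [eval_map, ← aeval_def] at hy
    simp only [map_sum, map_mul, eval_C, eval_map, ← aeval_def, ← hp _ ⟨y, hy⟩, ← mul_assoc]
    rw [← Finset.sum_mul, hsum ⟨y, hy⟩ trivial, zero_mul]
  have hzero := hp j x
  rw [eq_zero_of_sum_C_mul_map_eq_zero hc hsum_map, map_zero] at hzero
  exact (mul_eq_zero.1 hzero).resolve_right (pow_ne_zero _ x.2)

end PrincipalOpen

section SpecialLinearGroup

open Matrix

variable {ι α β K : Type*} [Fintype ι] [DecidableEq ι] [Field K]

/-- The subgroup of `SL` stabilizing the partial flag whose steps are spanned by the standard basis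
vectors `eᵢ` with `b i` at most a given bound. -/
def flagStabilizer [LinearOrder α] (b : ι → α) : Subgroup (Matrix.SpecialLinearGroup ι K) where
  carrier := {g | (g : Matrix ι ι K).BlockTriangular b}
  one_mem' := blockTriangular_one
  mul_mem' := BlockTriangular.mul
  inv_mem' {g} hg := by
    let _ : Invertible (g : Matrix ι ι K) :=
      invertibleOfRightInverse _ _ (congrArg Subtype.val (mul_inv_cancel g))
    have h := blockTriangular_inv_of_blockTriangular hg
    rwa [inv_eq_right_inv (congrArg Subtype.val (mul_inv_cancel g))] at h

theorem mem_flagStabilizer_iff [LinearOrder α] {b : ι → α} {g : Matrix.SpecialLinearGroup ι K} :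
    g ∈ flagStabilizer b ↔ ∀ i j, b j < b i → (g : Matrix ι ι K) i j = 0 :=
  Iff.rfl

theorem transvection_mem_flagStabilizer_iff [LinearOrder α] {b : ι → α} {i j : ι} (hij : i ≠ j) :
    Matrix.SpecialLinearGroup.transvection hij (1 : K) ∈ flagStabilizer b ↔ b i ≤ b j := by
  rw [mem_flagStabilizer_iff]
  constructor
  · intro h
    by_contra! hlt
    simpa [Matrix.SpecialLinearGroup.transvection_coe, hij] using h i j hlt
  · intro h r s hrs
    have hne : r ≠ s := by rintro rfl; exact hrs.false
    have : ¬(i = r ∧ j = s) := by rintro ⟨rfl, rfl⟩; exact hrs.not_ge h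
    simp [Matrix.SpecialLinearGroup.transvection_coe, hne, this]

theorem flagStabilizer_ne_flagStabilizer [LinearOrder α] [LinearOrder β] {b : ι → α} {c : ι → β}
    {i j : ι} (hb : b i ≤ b j) (hc : c j < c i) :
    (flagStabilizer b : Subgroup (Matrix.SpecialLinearGroup ι K)) ≠ flagStabilizer c := by
  intro h
  have hij : i ≠ j := by rintro rfl; exact hc.false
  have ht := (transvection_mem_flagStabilizer_iff (K := K) hij).2 hb
  exact hc.not_ge ((transvection_mem_flagStabilizer_iff hij).1 (h ▸ ht))

variable (ι K) in
theorem finite_center_specialLinearGroup :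
    Finite (Subgroup.center (Matrix.SpecialLinearGroup ι K)) :=
  have : NeZero (max (Fintype.card ι) 1) := ⟨by lia⟩
  Finite.of_equiv _ Matrix.SpecialLinearGroup.center_equiv_rootsOfUnity.symm.toEquiv

variable (ι K) in
theorem span_range_coe_specialLinearGroup [Nontrivial ι] :
    Submodule.span K (Set.range ((↑) : Matrix.SpecialLinearGroup ι K → Matrix ι ι K)) = ⊤ := by
  set V := Submodule.span K (Set.range ((↑) : Matrix.SpecialLinearGroup ι K → Matrix ι ι K))
  have hV (g : Matrix.SpecialLinearGroup ι K) : (g : Matrix ι ι K) ∈ V :=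
    Submodule.subset_span ⟨g, rfl⟩
  have hone : (1 : Matrix ι ι K) ∈ V := hV 1
  have hsingle (i j : ι) : single i j (1 : K) ∈ V := by
    rcases eq_or_ne i j with rfl | hij
    · obtain ⟨r, hr⟩ := exists_ne i
      let s := Matrix.SpecialLinearGroup.transvection hr.symm (1 : K)
      let t := Matrix.SpecialLinearGroup.transvection hr (1 : K)
      have h := add_mem (sub_mem (sub_mem (hV (s * t)) (hV s)) (hV t)) hone
      rw [Matrix.SpecialLinearGroup.coe_mul, Matrix.SpecialLinearGroup.transvection_coe,
        Matrix.SpecialLinearGroup.transvection_coe] at h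
      convert h using 1
      simp only [add_mul, mul_add, single_mul_single_same, mul_one, one_mul]
      abel
    · have h := sub_mem (hV (Matrix.SpecialLinearGroup.transvection hij 1)) hone
      rwa [Matrix.SpecialLinearGroup.transvection_coe, add_sub_cancel_left] at h
  refine (Submodule.eq_top_iff'.2 fun M => ?_)
  rw [matrix_eq_sum_single M]
  refine sum_mem fun i _ => sum_mem fun j _ => ?_
  rw [← mul_one (M i j), ← smul_eq_mul, ← smul_single]
  exact V.smul_mem _ (hsingle i j)

-- `tr (y · λ(a) x λ(a)⁻¹) = tr (λ(a)⁻¹ y λ(a) · x)` is polynomial both in `a` and in `a⁻¹`.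
theorem mem_center_of_forall_conj_mem_polynomialUnitFunctions [Infinite K] [Nontrivial ι]
    {m : Kˣ →* Matrix.SpecialLinearGroup ι K}
    (h : ∀ (g : Matrix.SpecialLinearGroup ι K) (i j : ι),
      (fun a => ((m a * g * (m a)⁻¹ : Matrix.SpecialLinearGroup ι K) : Matrix ι ι K) i j) ∈
        polynomialUnitFunctions K) (a : Kˣ) :
    m a ∈ Subgroup.center (Matrix.SpecialLinearGroup ι K) := by
  have hcomm (x y : Matrix.SpecialLinearGroup ι K) :
      trace ((x * y : Matrix.SpecialLinearGroup ι K) : Matrix ι ι K) =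
        trace ((y * x : Matrix.SpecialLinearGroup ι K) : Matrix ι ι K) := by
    rw [Matrix.SpecialLinearGroup.coe_mul, Matrix.SpecialLinearGroup.coe_mul, trace_mul_comm]
  let f (x y : Matrix.SpecialLinearGroup ι K) (a : Kˣ) : K :=
    trace ((y * (m a * x * (m a)⁻¹) : Matrix.SpecialLinearGroup ι K) : Matrix ι ι K)
  have hf (x y : Matrix.SpecialLinearGroup ι K) : f x y ∈ polynomialUnitFunctions K := by
    convert sum_mem fun i (_ : i ∈ Finset.univ) => sum_mem fun j (_ : j ∈ Finset.univ) =>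
      (polynomialUnitFunctions K).smul_mem (h x j i) (y i j) using 1
    ext a
    simp only [f, Matrix.SpecialLinearGroup.coe_mul y, trace, diag_apply]
    simp [Matrix.mul_apply (M := y.1)]
  have hf_inv (x y : Matrix.SpecialLinearGroup ι K) (a : Kˣ) : f x y a⁻¹ = f y x a := by
    simp only [f]
    rw [map_inv, inv_inv, ← mul_assoc, hcomm, hcomm x]
    simp only [mul_assoc]
  have hf_one (x y : Matrix.SpecialLinearGroup ι K) : f x y a = f x y 1 :=
    eq_apply_one_of_mem_polynomialUnitFunctions (hf x y) (by simpa only [hf_inv] using hf y x) a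
  have hconj (x : Matrix.SpecialLinearGroup ι K) : m a * x * (m a)⁻¹ = x := by
    refine Subtype.ext (ext_iff_trace_mul_left.2 fun y => ?_)
    induction (Submodule.eq_top_iff'.1 (span_range_coe_specialLinearGroup ι K) y) using
      Submodule.span_induction with
    | mem y hy =>
      obtain ⟨y, rfl⟩ := hy
      have h := hf_one x y
      simp only [f, map_one, inv_one, one_mul, mul_one, Matrix.SpecialLinearGroup.coe_mul y] at h
      exact h
    | zero => simp
    | add y z _ _ hy hz => simp only [add_mul, trace_add, hy, hz]
    | smul c y _ hy => simp only [smul_mul, trace_smul, hy]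
  exact Subgroup.mem_center_iff.2 fun x => (mul_inv_eq_iff_eq_mul.1 (hconj x)).symm

end SpecialLinearGroup

section FlagStabilizerChart

open Matrix MvPolynomial

variable {ι α k K : Type*} [LinearOrder α] [Field k] [Field K] [Algebra k K]

variable (k) in
/-- The matrix of indeterminates whose entries outside the block triangular shape given by `b` are
replaced by `0`. Its determinant defines the principal open set of an affine space that
parametrizes the flag stabilizer of `b`. -/
noncomputable def genericBlockTriangular (b : ι → α) : Matrix ι ι (MvPolynomial (ι × ι) k) :=
  of fun i j => if b j < b i then 0 else X (i, j)

theorem map_aeval_genericBlockTriangular {b : ι → α} {M : Matrix ι ι K} (hM : M.BlockTriangular b) :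
    (genericBlockTriangular k b).map (aeval fun p : ι × ι => M p.1 p.2) = M := by
  ext i j
  rcases lt_or_ge (b j) (b i) with h | h
  · simp [genericBlockTriangular, h, hM h]
  · simp [genericBlockTriangular, h.not_gt]

theorem blockTriangular_map_aeval_genericBlockTriangular (b : ι → α) (x : ι × ι → K) :
    ((genericBlockTriangular k b).map (aeval x)).BlockTriangular b := fun i j h => by
  simp [genericBlockTriangular, h]

variable [Fintype ι] [DecidableEq ι]

theorem det_map_aeval_genericBlockTriangular (b : ι → α) (x : ι × ι → K) :
    ((genericBlockTriangular k b).map (aeval x)).det =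
      aeval x (genericBlockTriangular k b).det :=
  (AlgHom.map_det (aeval x) _).symm

theorem det_genericBlockTriangular_ne_zero (b : ι → α) : (genericBlockTriangular k b).det ≠ 0 := by
  intro h
  have hone := det_map_aeval_genericBlockTriangular (k := k) (K := k) b
    fun p => (1 : Matrix ι ι k) p.1 p.2
  rw [h, map_zero, map_aeval_genericBlockTriangular blockTriangular_one, det_one] at hone
  exact one_ne_zero hone

/-- The parametrization of a flag stabilizer by a principal open subset of an affine space: row `r`
is divided by the determinant. -/
noncomputable def flagStabilizerChart (b : ι → α) (r : ι)
    (x : {x : ι × ι → K // aeval x (genericBlockTriangular k b).det ≠ 0}) :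
    Matrix.SpecialLinearGroup ι K :=
  let N := (genericBlockTriangular k b).map (aeval x.1)
  ⟨N.updateRow r ((aeval x.1 (genericBlockTriangular k b).det)⁻¹ • N r), by
    rw [det_updateRow_smul, updateRow_eq_self, det_map_aeval_genericBlockTriangular,
      inv_mul_cancel₀ x.2]⟩

theorem coe_flagStabilizerChart_apply (b : ι → α) (r : ι)
    (x : {x : ι × ι → K // aeval x (genericBlockTriangular k b).det ≠ 0}) (i j : ι) :
    (flagStabilizerChart b r x : Matrix ι ι K) i j =
      (if i = r then (aeval x.1 (genericBlockTriangular k b).det)⁻¹ else 1) *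
        aeval x.1 (genericBlockTriangular k b i j) := by
  rcases eq_or_ne i r with rfl | h <;> simp [flagStabilizerChart, *]

theorem range_flagStabilizerChart (b : ι → α) (r : ι) :
    Set.range (flagStabilizerChart (k := k) (K := K) b r) =
      (flagStabilizer b : Subgroup (Matrix.SpecialLinearGroup ι K)) := by
  refine Set.Subset.antisymm ?_ fun g hg => ?_
  · rintro _ ⟨x, rfl⟩ i j h
    rw [coe_flagStabilizerChart_apply,
      show aeval x.1 (genericBlockTriangular k b i j) = 0 from
        blockTriangular_map_aeval_genericBlockTriangular b x.1 h, mul_zero]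
  · have hmap := map_aeval_genericBlockTriangular (k := k) hg
    have hdet := det_map_aeval_genericBlockTriangular (k := k) b
      fun p => (g : Matrix ι ι K) p.1 p.2
    rw [hmap, g.2] at hdet
    refine ⟨⟨_, hdet ▸ one_ne_zero⟩, Matrix.SpecialLinearGroup.ext _ _ fun i j => ?_⟩
    simp only [coe_flagStabilizerChart_apply, ← hdet, inv_one, ite_self, one_mul]
    exact congrFun₂ hmap i j

theorem aeval_mem_principalOpen {τ : Type*} (q p : MvPolynomial τ k) :
    (fun x : {x : τ → K // aeval x q ≠ 0} => aeval x.1 p) ∈ principalOpen K q := by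
  induction p using MvPolynomial.induction_on with
  | C c =>
    simp only [aeval_C]
    exact (principalOpen K q).algebraMap_mem c
  | add p r hp hr =>
    simp only [map_add]
    exact add_mem hp hr
  | mul_X p i hp =>
    simp only [map_mul, aeval_X]
    exact mul_mem hp (Algebra.subset_adjoin (Set.mem_insert_of_mem _ ⟨i, rfl⟩))

theorem flagStabilizerChart_apply_mem_principalOpen (b : ι → α) (r i j : ι) :
    (fun x => (flagStabilizerChart b r x : Matrix ι ι K) i j) ∈
      principalOpen K (genericBlockTriangular k b).det := by
  simp only [coe_flagStabilizerChart_apply]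
  refine mul_mem ?_ (aeval_mem_principalOpen (genericBlockTriangular k b).det
    (genericBlockTriangular k b i j))
  split_ifs
  · exact Algebra.subset_adjoin (Set.mem_insert _ _)
  · exact one_mem _

end FlagStabilizerChart

section DiagonalCocharacter

theorem prod_zpow_eq_zpow_sum {ι G : Type*} [CommGroup G] (s : Finset ι) (a : G) (n : ι → ℤ) :
    ∏ i ∈ s, a ^ n i = a ^ ∑ i ∈ s, n i := by
  classical
  induction s using Finset.induction_on with
  | empty => simp
  | insert i s hi ih => rw [Finset.prod_insert hi, Finset.sum_insert hi, ih, zpow_add]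

open Matrix

variable {ι K : Type*} [Fintype ι] [DecidableEq ι] [Field K]

variable (K) in
/-- The cocharacter `a ↦ diag(a ^ n i)` of `SL`. -/
def diagonalCocharacter (n : ι → ℤ) (hn : ∑ i, n i = 0) :
    Kˣ →* Matrix.SpecialLinearGroup ι K where
  toFun a := ⟨diagonal fun i => ((a ^ n i : Kˣ) : K), by
    rw [det_diagonal, ← Units.coe_prod, prod_zpow_eq_zpow_sum, hn, zpow_zero, Units.val_one]⟩
  map_one' := by ext; simp
  map_mul' a b := Subtype.ext <| by
    simp only [mul_zpow, Units.val_mul]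
    exact (diagonal_mul_diagonal _ _).symm

theorem coe_diagonalCocharacter (n : ι → ℤ) (hn : ∑ i, n i = 0) (a : Kˣ) :
    (diagonalCocharacter K n hn a : Matrix ι ι K) = diagonal fun i => ((a ^ n i : Kˣ) : K) :=
  rfl

theorem diagonalCocharacter_mul_mul_inv_apply {n n' : ι → ℤ} (hn : ∑ i, n i = 0)
    (hn' : ∑ i, n' i = 0) (g : Matrix.SpecialLinearGroup ι K) (a : Kˣ) (i j : ι) :
    ((diagonalCocharacter K n hn a * g * (diagonalCocharacter K n' hn' a)⁻¹ :
      Matrix.SpecialLinearGroup ι K) : Matrix ι ι K) i j =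
        ((a ^ (n i - n' j) : Kˣ) : K) * (g : Matrix ι ι K) i j := by
  rw [← map_inv, Matrix.SpecialLinearGroup.coe_mul, Matrix.SpecialLinearGroup.coe_mul,
    coe_diagonalCocharacter, coe_diagonalCocharacter, mul_diagonal, diagonal_mul, _root_.inv_zpow,
    _root_.zpow_sub, Units.val_mul, mul_right_comm]

theorem exists_perm_comp_eq_of_det_ne_zero {M : Matrix ι ι K} (hM : M.det ≠ 0) {n n' : ι → ℤ}
    (hzero : ∀ i j, n i < n' j → M i j = 0) (hsum : ∑ i, n i = ∑ i, n' i) :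
    ∃ τ : Equiv.Perm ι, n ∘ τ = n' := by
  rw [det_apply] at hM
  obtain ⟨τ, -, hτ⟩ := Finset.exists_ne_zero_of_sum_ne_zero hM
  have hle (i : ι) : n' i ≤ n (τ i) := by
    by_contra! hlt
    have hprod := Finset.prod_eq_zero (f := fun i => M (τ i) i) (Finset.mem_univ i) (hzero _ _ hlt)
    exact hτ (by rw [hprod, smul_zero])
  have hsum' : ∑ i, n' i = ∑ i, n (τ i) := by rw [Equiv.sum_comp τ n, hsum]
  exact ⟨τ, funext fun i =>
    ((Finset.sum_eq_sum_iff_of_le fun i _ => hle i).1 hsum' i (Finset.mem_univ i)).symm⟩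

end DiagonalCocharacter

section SL3

open Matrix
open scoped MatrixGroups

variable {K : Type*} [Field K]

variable (K) in
/-- The stabilizer in `SL₃` of the line spanned by the first standard basis vector. -/
def lineStabilizer : Subgroup SL(3, K) :=
  flagStabilizer ![0, 1, 1]

variable (K) in
/-- The stabilizer in `SL₃` of the plane spanned by the first two standard basis vectors. -/
def planeStabilizer : Subgroup SL(3, K) :=
  flagStabilizer ![0, 0, 1]

theorem borelSL3_eq_flagStabilizer : borelSL3 K = flagStabilizer id :=
  rfl

theorem mem_borelSL3_iff {g : SL(3, K)} : g ∈ borelSL3 K ↔ g 1 0 = 0 ∧ g 2 0 = 0 ∧ g 2 1 = 0 := by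
  simp [borelSL3_eq_flagStabilizer, mem_flagStabilizer_iff, Fin.forall_fin_succ]

theorem mem_lineStabilizer_iff {g : SL(3, K)} : g ∈ lineStabilizer K ↔ g 1 0 = 0 ∧ g 2 0 = 0 := by
  simp [lineStabilizer, mem_flagStabilizer_iff, Fin.forall_fin_succ]

theorem mem_planeStabilizer_iff {g : SL(3, K)} : g ∈ planeStabilizer K ↔ g 2 0 = 0 ∧ g 2 1 = 0 := by
  simp [planeStabilizer, mem_flagStabilizer_iff, Fin.forall_fin_succ]

theorem lineStabilizer_inf_planeStabilizer :
    lineStabilizer K ⊓ planeStabilizer K = borelSL3 K := by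
  ext g
  rw [Subgroup.mem_inf, mem_lineStabilizer_iff, mem_planeStabilizer_iff, mem_borelSL3_iff]
  tauto

theorem borelSL3_le_lineStabilizer : borelSL3 K ≤ lineStabilizer K :=
  lineStabilizer_inf_planeStabilizer.ge.trans inf_le_left

theorem borelSL3_le_planeStabilizer : borelSL3 K ≤ planeStabilizer K :=
  lineStabilizer_inf_planeStabilizer.ge.trans inf_le_right

theorem SL3_mul_apply (g h : SL(3, K)) (i j : Fin 3) :
    (g * h) i j = g i 0 * h 0 j + g i 1 * h 1 j + g i 2 * h 2 j := by
  simp [mul_apply, Fin.sum_univ_three]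

/-- The upper triangular matrix with rows `(a, x, y)`, `(0, b, z)`, `(0, 0, c)`. -/
def upperSL3 (a b c x y z : K) (h : a * b * c = 1) : SL(3, K) :=
  ⟨!![a, x, y; 0, b, z; 0, 0, c], by simp [det_fin_three, h]⟩

theorem coe_upperSL3 (a b c x y z : K) (h : a * b * c = 1) :
    (upperSL3 a b c x y z h : Matrix (Fin 3) (Fin 3) K) = !![a, x, y; 0, b, z; 0, 0, c] :=
  rfl

theorem upperSL3_mem_borelSL3 {a b c x y z : K} {h : a * b * c = 1} :
    upperSL3 a b c x y z h ∈ borelSL3 K := by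
  simp [mem_borelSL3_iff, coe_upperSL3]

theorem inv_mul_mem_lineStabilizer {g h : SL(3, K)} (hgh : ∀ i, g i 0 = h i 0) :
    g⁻¹ * h ∈ lineStabilizer K := by
  have hcol (i : Fin 3) : (g⁻¹ * h) i 0 = (1 : SL(3, K)) i 0 := by
    rw [← inv_mul_cancel g, SL3_mul_apply, SL3_mul_apply, hgh, hgh, hgh]
  rw [mem_lineStabilizer_iff, hcol, hcol]
  simp

theorem exists_eq_mul_mul_of_apply_two_zero_ne_zero {g h : SL(3, K)} (hg : g 2 0 ≠ 0)
    (hh : h 2 0 ≠ 0) : ∃ b ∈ borelSL3 K, ∃ p ∈ lineStabilizer K, h = b * g * p := by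
  let b := upperSL3 (g 2 0 / h 2 0) 1 (h 2 0 / g 2 0) 0 ((h 0 0 - g 2 0 / h 2 0 * g 0 0) / g 2 0)
    ((h 1 0 - g 1 0) / g 2 0) (by field_simp)
  refine ⟨b, upperSL3_mem_borelSL3, (b * g)⁻¹ * h, inv_mul_mem_lineStabilizer fun i => ?_,
    (mul_inv_cancel_left _ _).symm⟩
  fin_cases i <;> simp [SL3_mul_apply, b, coe_upperSL3] <;> field_simp <;> ring

theorem exists_eq_mul_mul_of_apply_one_zero_ne_zero {g h : SL(3, K)} (hg : g ∈ planeStabilizer K)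
    (hh : h ∈ planeStabilizer K) (hg₁ : g 1 0 ≠ 0) (hh₁ : h 1 0 ≠ 0) :
    ∃ b ∈ borelSL3 K, ∃ b' ∈ borelSL3 K, h = b * g * b' := by
  let b := upperSL3 1 (h 1 0 / g 1 0) (g 1 0 / h 1 0) ((h 0 0 - g 0 0) / g 1 0) 0 0 (by field_simp)
  have hb : b ∈ borelSL3 K := upperSL3_mem_borelSL3
  refine ⟨b, hb, (b * g)⁻¹ * h, ?_, (mul_inv_cancel_left _ _).symm⟩
  rw [← lineStabilizer_inf_planeStabilizer]
  refine Subgroup.mem_inf.2 ⟨inv_mul_mem_lineStabilizer fun i => ?_,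
    mul_mem (inv_mem (mul_mem (borelSL3_le_planeStabilizer hb) hg)) hh⟩
  rw [mem_planeStabilizer_iff] at hg hh
  fin_cases i <;> simp [SL3_mul_apply, b, coe_upperSL3, hg.1, hh.1] <;> field_simp
  ring

end SL3

section Duality

open Matrix
open scoped MatrixGroups

variable {K : Type*} [Field K]

theorem graphAutomorphism_apply_apply (g : SL(3, K)) (i j : Fin 3) :
    graphAutomorphism K g i j = (-1) ^ (i + j : ℕ) * g⁻¹ j.rev i.rev := by
  have hinv : (longestElement K)⁻¹ = longestElement K := by
    ext i j
    fin_cases i <;> fin_cases j <;> simp [coe_longestElement, adjugate_fin_three]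
  change graphMap K g i j = _
  rw [graphMap, hinv]
  simp only [SL3_mul_apply, coe_longestElement]
  fin_cases i <;> fin_cases j <;> simp [adjugate_fin_three, Fin.rev] <;> ring

theorem graphAutomorphism_mul_self : graphAutomorphism K * graphAutomorphism K = 1 :=
  MulEquiv.ext graphMap_graphMap

theorem graphAutomorphism_graphAutomorphism (g : SL(3, K)) :
    graphAutomorphism K (graphAutomorphism K g) = g :=
  graphMap_graphMap g

theorem graphAutomorphism_mem_lineStabilizer_iff {g : SL(3, K)} :
    graphAutomorphism K g ∈ lineStabilizer K ↔ g ∈ planeStabilizer K := by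
  rw [← inv_mem_iff (x := g), mem_lineStabilizer_iff, mem_planeStabilizer_iff,
    graphAutomorphism_apply_apply, graphAutomorphism_apply_apply]
  simp [-SpecialLinearGroup.coe_inv, and_comm]

theorem graphAutomorphism_mem_planeStabilizer_iff {g : SL(3, K)} :
    graphAutomorphism K g ∈ planeStabilizer K ↔ g ∈ lineStabilizer K := by
  rw [← graphAutomorphism_mem_lineStabilizer_iff, graphAutomorphism_graphAutomorphism]

theorem graphAutomorphism_mem_borelSL3_iff {g : SL(3, K)} :
    graphAutomorphism K g ∈ borelSL3 K ↔ g ∈ borelSL3 K := by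
  rw [← lineStabilizer_inf_planeStabilizer, Subgroup.mem_inf, Subgroup.mem_inf,
    graphAutomorphism_mem_lineStabilizer_iff, graphAutomorphism_mem_planeStabilizer_iff, and_comm]

theorem graphAutomorphism_ne_one : graphAutomorphism K ≠ 1 := by
  intro h
  let t : SL(3, K) := Matrix.SpecialLinearGroup.transvection (by decide : (2 : Fin 3) ≠ 1) 1
  have ht_line : t ∈ lineStabilizer K := (transvection_mem_flagStabilizer_iff _).2 (by decide)
  have ht_plane : t ∉ planeStabilizer K :=
    mt (transvection_mem_flagStabilizer_iff _).1 (by decide)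
  exact ht_plane (graphAutomorphism_mem_lineStabilizer_iff.1 (by rwa [h]))

end Duality

section SubgroupsOfSL3

open Matrix
open scoped MatrixGroups

variable {K : Type*} [Field K] {Q : Subgroup SL(3, K)}

theorem planeStabilizer_le (hQ : borelSL3 K ≤ Q) {g : SL(3, K)} (hg : g ∈ Q)
    (hg_plane : g ∈ planeStabilizer K) (hg_borel : g ∉ borelSL3 K) : planeStabilizer K ≤ Q := by
  have apply_ne_zero {x : SL(3, K)} (hx : x ∈ planeStabilizer K) (hx' : x ∉ borelSL3 K) :
      x 1 0 ≠ 0 :=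
    fun h => hx' (mem_borelSL3_iff.2 ⟨h, mem_planeStabilizer_iff.1 hx⟩)
  intro h hh
  by_cases hh_borel : h ∈ borelSL3 K
  · exact hQ hh_borel
  · obtain ⟨b, hb, b', hb', rfl⟩ := exists_eq_mul_mul_of_apply_one_zero_ne_zero hg_plane hh
      (apply_ne_zero hg_plane hg_borel) (apply_ne_zero hh hh_borel)
    exact mul_mem (mul_mem (hQ hb) hg) (hQ hb')

theorem lineStabilizer_le (hQ : borelSL3 K ≤ Q) {g : SL(3, K)} (hg : g ∈ Q)
    (hg_line : g ∈ lineStabilizer K) (hg_borel : g ∉ borelSL3 K) : lineStabilizer K ≤ Q := by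
  have hdual : planeStabilizer K ≤ Q.comap (graphAutomorphism K).toMonoidHom :=
    planeStabilizer_le (g := graphAutomorphism K g)
      (fun x hx => hQ (graphAutomorphism_mem_borelSL3_iff.2 hx))
      (by simpa [graphAutomorphism_graphAutomorphism] using hg)
      (graphAutomorphism_mem_planeStabilizer_iff.2 hg_line)
      (mt graphAutomorphism_mem_borelSL3_iff.1 hg_borel)
  intro h hh
  simpa [graphAutomorphism_graphAutomorphism] using
    hdual (graphAutomorphism_mem_planeStabilizer_iff.2 hh)

theorem conj_transvection_apply {ι : Type*} [Fintype ι] [DecidableEq ι]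
    (g : Matrix.SpecialLinearGroup ι K) {i j : ι} (hij : i ≠ j) (c : K) (r s : ι) :
    (g * Matrix.SpecialLinearGroup.transvection hij c * g⁻¹) r s =
      (1 : Matrix ι ι K) r s + g r i * c * g⁻¹ j s := by
  have h : ((g * Matrix.SpecialLinearGroup.transvection hij c * g⁻¹ :
      Matrix.SpecialLinearGroup ι K) : Matrix ι ι K) =
        1 + (g : Matrix ι ι K) * single i j c * (g⁻¹ : Matrix.SpecialLinearGroup ι K) := by
    rw [Matrix.SpecialLinearGroup.coe_mul, Matrix.SpecialLinearGroup.coe_mul,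
      Matrix.SpecialLinearGroup.transvection_coe, mul_add, mul_one, add_mul,
      ← Matrix.SpecialLinearGroup.coe_mul, mul_inv_cancel, Matrix.SpecialLinearGroup.coe_one]
  rw [h, Matrix.add_apply, Matrix.mul_apply, Finset.sum_eq_single j]
  · simp
  · intro t _ ht
    rw [mul_single_apply_of_ne _ _ _ _ _ ht, zero_mul]
  · simp

theorem exists_mem_lineStabilizer_notMem_borelSL3 (hQ : borelSL3 K ≤ Q) {g : SL(3, K)}
    (hg : g ∈ Q) (h20 : g 2 0 ≠ 0) : ∃ h ∈ Q, h ∈ lineStabilizer K ∧ h ∉ borelSL3 K := by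
  have hg_inv : g⁻¹ ∉ planeStabilizer K := fun h =>
    h20 (mem_planeStabilizer_iff.1 (inv_mem_iff.1 h)).1
  by_cases hf : g⁻¹ 2 0 = 0
  · let t : SL(3, K) := Matrix.SpecialLinearGroup.transvection (by decide : (0 : Fin 3) ≠ 2) 1
    have ht : t ∈ borelSL3 K := (transvection_mem_flagStabilizer_iff (b := id) _).2 (by decide)
    have hf1 : g⁻¹ 2 1 ≠ 0 := fun h => hg_inv (mem_planeStabilizer_iff.2 ⟨hf, h⟩)
    refine ⟨g * t * g⁻¹, mul_mem (mul_mem hg (hQ ht)) (inv_mem hg), ?_, fun h => ?_⟩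
    · simp only [mem_lineStabilizer_iff, t, conj_transvection_apply, hf]
      simp
    · have h21 := (mem_borelSL3_iff.1 h).2.2
      simp only [t, conj_transvection_apply] at h21
      exact mul_ne_zero h20 hf1 (by simpa using h21)
  · let b : SL(3, K) := upperSL3 1 1 1 (g 2 0) (-g 1 0) 0 (by simp)
    refine ⟨g⁻¹ * (b * g), mul_mem (inv_mem hg) (mul_mem (hQ upperSL3_mem_borelSL3) hg),
      inv_mul_mem_lineStabilizer fun i => ?_, fun h => ?_⟩
    · fin_cases i <;> simp [SL3_mul_apply, b, coe_upperSL3]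
      ring
    · have h21 : (g⁻¹ * (b * g)) 2 1 = -(g⁻¹ 2 0 * g⁻¹ 2 0) := by
        simp [SL3_mul_apply, b, coe_upperSL3, adjugate_fin_three]
        ring
      exact neg_ne_zero.2 (mul_ne_zero hf hf) (h21.symm.trans (mem_borelSL3_iff.1 h).2.2)

theorem eq_top_of_borelSL3_le (hQ : borelSL3 K ≤ Q) {g : SL(3, K)} (hg : g ∈ Q)
    (h20 : g 2 0 ≠ 0) : Q = ⊤ := by
  obtain ⟨t, ht, ht_line, ht_borel⟩ := exists_mem_lineStabilizer_notMem_borelSL3 hQ hg h20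
  have hline := lineStabilizer_le hQ ht ht_line ht_borel
  have hcell (h : SL(3, K)) (hh : h 2 0 ≠ 0) : h ∈ Q := by
    obtain ⟨b, hb, p, hp, rfl⟩ := exists_eq_mul_mul_of_apply_two_zero_ne_zero h20 hh
    exact mul_mem (mul_mem (hQ hb) hg) (hline hp)
  refine eq_top_iff.2 fun h _ => ?_
  by_cases hh20 : h 2 0 = 0
  · by_cases hh10 : h 1 0 = 0
    · exact hline (mem_lineStabilizer_iff.2 ⟨hh10, hh20⟩)
    · let u : SL(3, K) := Matrix.SpecialLinearGroup.transvection (by decide : (2 : Fin 3) ≠ 1) 1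
      have hu : u ∈ lineStabilizer K := (transvection_mem_flagStabilizer_iff _).2 (by decide)
      refine (Q.mul_mem_cancel_left (hline hu)).1 (hcell _ ?_)
      simpa [SL3_mul_apply, u, Matrix.SpecialLinearGroup.transvection_coe, hh20] using hh10
  · exact hcell h hh20

theorem eq_of_borelSL3_le (hQ : borelSL3 K ≤ Q) :
    Q = borelSL3 K ∨ Q = lineStabilizer K ∨ Q = planeStabilizer K ∨ Q = ⊤ := by
  by_cases hQ_top : Q = ⊤
  · exact .inr (.inr (.inr hQ_top))
  have h20 (g : SL(3, K)) (hg : g ∈ Q) : g 2 0 = 0 :=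
    of_not_not fun h => hQ_top (eq_top_of_borelSL3_le hQ hg h)
  by_cases hline : Q ≤ lineStabilizer K
  · rcases hQ.eq_or_lt with hB | hlt
    · exact .inl hB.symm
    · obtain ⟨g, hg, hg_borel⟩ := SetLike.exists_of_lt hlt
      exact .inr (.inl (hline.antisymm (lineStabilizer_le hQ hg (hline hg) hg_borel)))
  · obtain ⟨g, hg, hg_line⟩ := SetLike.not_le_iff_exists.1 hline
    have h10 : g 1 0 ≠ 0 := fun h => hg_line (mem_lineStabilizer_iff.2 ⟨h, h20 g hg⟩)
    have hplane : Q ≤ planeStabilizer K := fun h hh => by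
      have := h20 _ (mul_mem hh hg)
      rw [SL3_mul_apply, h20 h hh, h20 g hg] at this
      exact mem_planeStabilizer_iff.2 ⟨h20 h hh, by simpa [h10] using this⟩
    refine .inr (.inr (.inl (hplane.antisymm (planeStabilizer_le hQ hg (hplane hg) ?_))))
    exact fun hg_borel => h10 (mem_borelSL3_iff.1 hg_borel).1

theorem mem_lineStabilizer_of_forall_conj_mem {g : SL(3, K)}
    (h : ∀ b ∈ borelSL3 K, g * b * g⁻¹ ∈ lineStabilizer K) : g ∈ lineStabilizer K := by
  by_contra hg
  have hg_inv (j : Fin 3) (hj : 0 ≠ j) : g⁻¹ j 0 = 0 := by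
    have ht := mem_lineStabilizer_iff.1
      (h _ ((transvection_mem_flagStabilizer_iff (b := id) hj).2 (Fin.zero_le j)))
    simp only [conj_transvection_apply] at ht
    by_contra hj0
    exact hg (mem_lineStabilizer_iff.2
      (by simpa [-Matrix.SpecialLinearGroup.coe_inv, hj0] using ht))
  exact hg (inv_mem_iff.1 (mem_lineStabilizer_iff.2
    ⟨hg_inv 1 (by decide), hg_inv 2 (by decide)⟩))

theorem mem_planeStabilizer_of_forall_conj_mem {g : SL(3, K)}
    (h : ∀ b ∈ borelSL3 K, g * b * g⁻¹ ∈ planeStabilizer K) : g ∈ planeStabilizer K := by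
  rw [← graphAutomorphism_mem_lineStabilizer_iff]
  refine mem_lineStabilizer_of_forall_conj_mem fun b hb => ?_
  rw [← graphAutomorphism_mem_planeStabilizer_iff]
  simpa [graphAutomorphism_graphAutomorphism] using h _ (graphAutomorphism_mem_borelSL3_iff.2 hb)

theorem mem_borelSL3_of_forall_conj_mem {g : SL(3, K)}
    (h : ∀ b ∈ borelSL3 K, g * b * g⁻¹ ∈ borelSL3 K) : g ∈ borelSL3 K := by
  rw [← lineStabilizer_inf_planeStabilizer]
  exact ⟨mem_lineStabilizer_of_forall_conj_mem fun b hb => borelSL3_le_lineStabilizer (h b hb),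
    mem_planeStabilizer_of_forall_conj_mem fun b hb => borelSL3_le_planeStabilizer (h b hb)⟩

theorem exists_conj_notMem_lineStabilizer (g : SL(3, K)) :
    ∃ p ∈ planeStabilizer K, g * p * g⁻¹ ∉ lineStabilizer K := by
  by_contra! h
  have hg := mem_lineStabilizer_of_forall_conj_mem fun b hb => h b (borelSL3_le_planeStabilizer hb)
  have ht := mem_lineStabilizer_iff.1 (h _ ((transvection_mem_flagStabilizer_iff (K := K)
    (b := ![0, 0, 1]) (i := 1) (j := 0) (by decide)).2 (by decide)))
  simp only [conj_transvection_apply] at ht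
  have det_eq_zero {x : SL(3, K)} (hx : x ∈ lineStabilizer K)
      (h : x 0 0 = 0 ∨ (x 1 1 = 0 ∧ x 2 1 = 0)) : (x : Matrix (Fin 3) (Fin 3) K).det = 0 := by
    rw [mem_lineStabilizer_iff] at hx
    rcases h with h | ⟨h11, h21⟩
    · rw [det_fin_three]
      simp [hx, h]
    · rw [det_fin_three]
      simp [hx, h11, h21]
  have det_ne_zero (x : SL(3, K)) : (x : Matrix (Fin 3) (Fin 3) K).det ≠ 0 := by simp
  have h00 : g⁻¹ 0 0 ≠ 0 := fun h => det_ne_zero _ (det_eq_zero (inv_mem hg) (.inl h))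
  exact det_ne_zero _ (det_eq_zero hg
    (.inr (by simpa [-Matrix.SpecialLinearGroup.coe_inv, h00] using ht)))

theorem exists_conj_notMem_planeStabilizer (g : SL(3, K)) :
    ∃ p ∈ lineStabilizer K, g * p * g⁻¹ ∉ planeStabilizer K := by
  obtain ⟨p, hp, hgp⟩ := exists_conj_notMem_lineStabilizer (graphAutomorphism K g)
  refine ⟨graphAutomorphism K p, graphAutomorphism_mem_lineStabilizer_iff.2 hp, ?_⟩
  rw [← graphAutomorphism_mem_lineStabilizer_iff]
  simpa [graphAutomorphism_graphAutomorphism] using hgp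

theorem commute_single_of_commute_transvection {ι : Type*} [Fintype ι] [DecidableEq ι]
    {g : Matrix.SpecialLinearGroup ι K} {i j : ι} {hij : i ≠ j}
    (h : Commute g (Matrix.SpecialLinearGroup.transvection hij 1)) :
    Commute (single i j (1 : K)) (g : Matrix ι ι K) := by
  have hmul := congrArg Subtype.val h.eq
  change (g : Matrix ι ι K) * (1 + single i j 1) = (1 + single i j 1) * (g : Matrix ι ι K) at hmul
  rw [mul_add, add_mul, mul_one, one_mul] at hmul
  exact (add_left_cancel hmul).symm

theorem mem_center_of_forall_commute_borelSL3 [Infinite K] {g : SL(3, K)}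
    (h : ∀ b ∈ borelSL3 K, Commute g b) : g ∈ Subgroup.center SL(3, K) := by
  have hsingle (i j : Fin 3) (hij : i < j) : Commute (single i j (1 : K)) (g : Matrix _ _ K) :=
    commute_single_of_commute_transvection
      (h _ ((transvection_mem_flagStabilizer_iff (b := id) hij.ne).2 hij.le))
  have h01 := hsingle 0 1 (by decide)
  have h12 := hsingle 1 2 (by decide)
  have h02 : g 0 2 = 0 := by
    classical
    obtain ⟨c, hc⟩ := Infinite.exists_notMem_finset ({0, 1} : Finset K)
    obtain ⟨hc0, hc1⟩ : c ≠ 0 ∧ c ≠ 1 := by simpa using hc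
    have hn : ∑ i, ![1, -1, 0] i = (0 : ℤ) := by decide
    let d := diagonalCocharacter K ![1, -1, 0] hn (Units.mk0 c hc0)
    have hd : d ∈ borelSL3 K := fun i j hij => diagonal_apply_ne _ hij.ne'
    have hconj := diagonalCocharacter_mul_mul_inv_apply hn hn g (Units.mk0 c hc0) 0 2
    rw [(h d hd).symm.mul_inv_cancel] at hconj
    exact eq_zero_of_mul_eq_self_left hc1 (by simpa using hconj.symm)
  have hscalar : scalar (Fin 3) (g 0 0) = (g : Matrix (Fin 3) (Fin 3) K) := by
    have h11 := diag_eq_of_commute_single h01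
    have h22 := diag_eq_of_commute_single h12
    ext i j
    fin_cases i <;> fin_cases j <;>
      simp [h02, h11, h22, row_eq_zero_of_commute_single h01, row_eq_zero_of_commute_single h12,
        col_eq_zero_of_commute_single h12]
  refine Subgroup.mem_center_iff.2 fun x => Subtype.ext ?_
  rw [Matrix.SpecialLinearGroup.coe_mul, Matrix.SpecialLinearGroup.coe_mul, ← hscalar]
  exact (scalar_commute _ (Commute.all _) _).symm

end SubgroupsOfSL3

section ExtendedSL3

open Matrix
open scoped MatrixGroups

variable {K : Type*} [Field K] {P : Subgroup (ExtendedSL3 K)}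

theorem sigma_right_ne_one : (sigma K).right ≠ 1 :=
  fun h => graphAutomorphism_ne_one (congrArg Subtype.val h)

theorem eq_one_or_eq_sigma_right (s : Subgroup.zpowers (graphAutomorphism K)) :
    s = 1 ∨ s = (sigma K).right := by
  obtain ⟨s, n, rfl⟩ := s
  have hsq : graphAutomorphism K ^ (2 : ℤ) = 1 := graphAutomorphism_mul_self
  obtain ⟨m, rfl | rfl⟩ := Int.even_or_odd' n
  · exact .inl (Subtype.ext (by simp [_root_.zpow_mul, hsq]))
  · exact .inr (Subtype.ext (by simp [_root_.zpow_add, _root_.zpow_mul, hsq, sigma]))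

instance : Finite (Subgroup.zpowers (graphAutomorphism K)) :=
  Finite.of_surjective (fun b : Bool => if b then 1 else (sigma K).right) fun s =>
    (eq_one_or_eq_sigma_right s).elim (fun h => ⟨true, h.symm⟩) fun h => ⟨false, h.symm⟩

theorem mem_map_inl_iff {Q : Subgroup SL(3, K)} {x : ExtendedSL3 K} :
    x ∈ Q.map SemidirectProduct.inl ↔ x.right = 1 ∧ x.left ∈ Q := by
  constructor
  · rintro ⟨g, hg, rfl⟩
    exact ⟨rfl, hg⟩
  · rintro ⟨hright, hleft⟩
    exact ⟨x.left, hleft, SemidirectProduct.ext rfl hright.symm⟩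

theorem mul_inl_mul_inv (x : ExtendedSL3 K) (g : SL(3, K)) :
    x * SemidirectProduct.inl g * x⁻¹ =
      SemidirectProduct.inl (x.left * x.right.1 g * x.left⁻¹) := by
  conv_lhs => rw [← SemidirectProduct.inl_left_mul_inr_right x]
  rw [_root_.mul_inv_rev, map_mul, map_mul, map_inv, ← Subgroup.coe_subtype,
    SemidirectProduct.inl_aut]
  simp only [mul_assoc, map_inv]

theorem mem_iff_inl_left_mem (hP : sigma K ∈ P) {x : ExtendedSL3 K} :
    x ∈ P ↔ SemidirectProduct.inl x.left ∈ P := by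
  have hright : SemidirectProduct.inr x.right ∈ P := by
    rcases eq_one_or_eq_sigma_right x.right with h | h <;> rw [h]
    · exact P.one_mem
    · exact hP
  conv_lhs => rw [← SemidirectProduct.inl_left_mul_inr_right x]
  exact P.mul_mem_cancel_right hright

theorem apply_mem_borelSL3_iff (s : Subgroup.zpowers (graphAutomorphism K)) {g : SL(3, K)} :
    s.1 g ∈ borelSL3 K ↔ g ∈ borelSL3 K := by
  rcases eq_one_or_eq_sigma_right s with rfl | rfl
  · rfl
  · exact graphAutomorphism_mem_borelSL3_iff

variable (K) in
/-- The subgroup `B ⋊ ⟨σ⟩`, where `B` is the upper triangular Borel subgroup. -/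
def extendedBorel : Subgroup (ExtendedSL3 K) where
  carrier := {x | x.left ∈ borelSL3 K}
  one_mem' := one_mem (borelSL3 K)
  mul_mem' {x _} hx hy := mul_mem (s := borelSL3 K) hx ((apply_mem_borelSL3_iff x.right).2 hy)
  inv_mem' {x} hx := (apply_mem_borelSL3_iff (x.right⁻¹)).2 (inv_mem (S := Subgroup SL(3, K)) hx)

theorem mem_extendedBorel_iff {x : ExtendedSL3 K} : x ∈ extendedBorel K ↔ x.left ∈ borelSL3 K :=
  Iff.rfl

theorem sigma_mem_extendedBorel : sigma K ∈ extendedBorel K :=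
  one_mem (borelSL3 K)

theorem borelSubgroup_le_extendedBorel : borelSubgroup K ≤ extendedBorel K :=
  fun _ hx => (mem_map_inl_iff.1 hx).2

theorem extendedBorel_eq_closure :
    extendedBorel K =
      Subgroup.closure (insert (sigma K) (borelSubgroup K : Set (ExtendedSL3 K))) := by
  apply le_antisymm
  · intro x hx
    exact (mem_iff_inl_left_mem (Subgroup.subset_closure (.inl rfl))).2
      (Subgroup.subset_closure (.inr (Subgroup.mem_map_of_mem _ hx)))
  · rw [Subgroup.closure_le, Set.insert_subset_iff]
    exact ⟨sigma_mem_extendedBorel, borelSubgroup_le_extendedBorel⟩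

theorem eq_extendedBorel_or_eq_top (hP : borelSubgroup K ≤ P) {x : ExtendedSL3 K} (hx : x ∈ P)
    (hx_right : x.right = (sigma K).right) : P = extendedBorel K ∨ P = ⊤ := by
  let Q : Subgroup SL(3, K) := P.comap SemidirectProduct.inl
  have hconj (R S : Subgroup SL(3, K)) (hR : Q = R)
      (hS : ∀ g, graphAutomorphism K g ∈ R ↔ g ∈ S) : ∀ g ∈ S, x.left * g * x.left⁻¹ ∈ R := by
    intro g hg
    subst hR
    have hmem := mul_mem (mul_mem hx ((hS g).2 hg)) (inv_mem hx)
    rw [mul_inl_mul_inv, hx_right] at hmem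
    change x.left * graphAutomorphism K (graphAutomorphism K g) * x.left⁻¹ ∈ Q at hmem
    rwa [graphAutomorphism_graphAutomorphism] at hmem
  have hsigma (hleft : x.left ∈ Q) : sigma K ∈ P := by
    rw [← SemidirectProduct.inl_left_mul_inr_right x, hx_right] at hx
    exact (P.mul_mem_cancel_left hleft).1 hx
  have hQ : borelSL3 K ≤ Q := Subgroup.map_le_iff_le_comap.1 hP
  rcases eq_of_borelSL3_le hQ with h | h | h | h
  · have hleft := mem_borelSL3_of_forall_conj_mem
      (hconj _ _ h fun _ => graphAutomorphism_mem_borelSL3_iff)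
    refine .inl (SetLike.ext fun y => (mem_iff_inl_left_mem (hsigma (h ▸ hleft))).trans ?_)
    exact SetLike.ext_iff.1 h y.left
  · obtain ⟨p, hp, hxp⟩ := exists_conj_notMem_lineStabilizer x.left
    exact absurd (hconj _ _ h (fun _ => graphAutomorphism_mem_lineStabilizer_iff) p hp) hxp
  · obtain ⟨p, hp, hxp⟩ := exists_conj_notMem_planeStabilizer x.left
    exact absurd (hconj _ _ h (fun _ => graphAutomorphism_mem_planeStabilizer_iff) p hp) hxp
  · have hmem (g : SL(3, K)) : g ∈ Q := h ▸ Subgroup.mem_top g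
    exact .inr (eq_top_iff.2 fun y _ => (mem_iff_inl_left_mem (hsigma (hmem _))).2 (hmem y.left))

theorem eq_of_borelSubgroup_le (hP : borelSubgroup K ≤ P) :
    P = borelSubgroup K ∨ P = (lineStabilizer K).map SemidirectProduct.inl ∨
      P = (planeStabilizer K).map SemidirectProduct.inl ∨ P = extendedBorel K ∨
      P = (⊤ : Subgroup SL(3, K)).map SemidirectProduct.inl ∨ P = ⊤ := by
  by_cases hright : ∀ x ∈ P, x.right = 1
  · have hP_eq : P = (P.comap SemidirectProduct.inl).map SemidirectProduct.inl :=
      (Subgroup.map_comap_eq_self fun x hx =>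
        ⟨x.left, SemidirectProduct.ext rfl (hright x hx).symm⟩).symm
    rcases eq_of_borelSL3_le (Subgroup.map_le_iff_le_comap.1 hP) with h | h | h | h <;>
      rw [h] at hP_eq <;> simp [hP_eq, borelSubgroup]
  · push Not at hright
    obtain ⟨x, hx, hx_right⟩ := hright
    rcases eq_extendedBorel_or_eq_top hP hx ((eq_one_or_eq_sigma_right _).resolve_left hx_right)
      with h | h <;> simp [h]

end ExtendedSL3

section CoordinateRing

open Matrix
open scoped MatrixGroups

variable {k K X : Type*} [Field k] [Field K] [Algebra k K]

theorem entry_mem_coordinateRing (i j : Fin 3) :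
    (fun g : ExtendedSL3 K => g.left i j) ∈ coordinateRing k K :=
  Algebra.subset_adjoin (.inl ⟨i, j, rfl⟩)

open Classical in
theorem indicator_right_mem_coordinateRing (s : Subgroup.zpowers (graphAutomorphism K)) :
    (fun g : ExtendedSL3 K => if g.right = s then (1 : K) else 0) ∈ coordinateRing k K :=
  Algebra.subset_adjoin (.inr ⟨s, rfl⟩)

variable (k K) in
theorem separatesPoints_coordinateRing :
    (coordinateRing k K : Set (ExtendedSL3 K → K)).SeparatesPoints := by
  classical
  intro x y hxy
  by_contra! h
  refine hxy (SemidirectProduct.ext ?_ ?_)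
  · ext i j
    exact h _ (entry_mem_coordinateRing i j)
  · by_contra hright
    simpa [hright] using h _ (indicator_right_mem_coordinateRing y.right)

theorem comp_right_mem_regularFunctions (f : Subgroup.zpowers (graphAutomorphism K) → K) :
    (fun g : ExtendedSL3 K => f g.right) ∈ regularFunctions (coordinateRing k K) := by
  classical
  cases nonempty_fintype (Subgroup.zpowers (graphAutomorphism K))
  have hf : (fun g : ExtendedSL3 K => f g.right) =
      ∑ s, f s • fun g : ExtendedSL3 K => if g.right = s then (1 : K) else 0 := by
    ext g
    simp
  rw [hf]
  exact sum_mem fun s _ => Subalgebra.smul_mem _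
    (mem_regularFunctions_of_mem (indicator_right_mem_coordinateRing s)) (f s)

theorem isMorphism_coordinateRing {A : Subalgebra k (X → K)} {φ : X → ExtendedSL3 K}
    (hleft : ∀ i j, (fun x => (φ x).left i j) ∈ regularFunctions A)
    (hright : ∀ f : Subgroup.zpowers (graphAutomorphism K) → K,
      (fun x => f (φ x).right) ∈ regularFunctions A) :
    IsMorphism A (coordinateRing k K) φ := by
  classical
  refine isMorphism_adjoin ?_
  rintro _ (⟨i, j, rfl⟩ | ⟨s, rfl⟩)
  · exact hleft i j
  · exact hright fun t => if t = s then 1 else 0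

theorem isMorphism_mk {A : Subalgebra k (X → K)} {φ : X → SL(3, K)}
    (s : Subgroup.zpowers (graphAutomorphism K))
    (hφ : ∀ i j, (fun x => φ x i j) ∈ regularFunctions A) :
    IsMorphism A (coordinateRing k K) fun x => ⟨φ x, s⟩ :=
  isMorphism_coordinateRing hφ fun f => (regularFunctions A).algebraMap_mem (f s)

theorem comp_mk_mem_of_mem_coordinateRing {A : Subalgebra k (X → K)} {φ : X → SL(3, K)}
    (s : Subgroup.zpowers (graphAutomorphism K)) (hφ : ∀ i j, (fun x => φ x i j) ∈ A)
    {f : ExtendedSL3 K → K} (hf : f ∈ coordinateRing k K) : (fun x => f ⟨φ x, s⟩) ∈ A := by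
  classical
  induction hf using Algebra.adjoin_induction with
  | mem f hf =>
    obtain ⟨i, j, rfl⟩ | ⟨t, rfl⟩ := hf
    · exact hφ i j
    · change (fun _ => if s = t then (1 : K) else 0) ∈ A
      split_ifs
      exacts [A.one_mem, A.zero_mem]
  | algebraMap c => exact A.algebraMap_mem c
  | add f g _ _ hf hg => exact A.add_mem hf hg
  | mul f g _ _ hf hg => exact A.mul_mem hf hg

theorem isMorphism_inr_right :
    IsMorphism (coordinateRing k K) (coordinateRing k K)
      fun g => SemidirectProduct.inr g.right :=
  isMorphism_coordinateRing
    (fun i j => (regularFunctions _).algebraMap_mem ((1 : Matrix (Fin 3) (Fin 3) K) i j))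
    comp_right_mem_regularFunctions

theorem isMorphism_conj_inl (m : SL(3, K)) :
    IsMorphism (coordinateRing k K) (coordinateRing k K)
      fun g => SemidirectProduct.inl m * g * (SemidirectProduct.inl m)⁻¹ := by
  have hentry (i j : Fin 3) :
      (fun g : ExtendedSL3 K => g.left i j) ∈ regularFunctions (coordinateRing k K) :=
    mem_regularFunctions_of_mem (entry_mem_coordinateRing i j)
  refine isMorphism_coordinateRing (fun i j => ?_) fun f => ?_
  · have hleft (g : ExtendedSL3 K) :
        (SemidirectProduct.inl m * g * (SemidirectProduct.inl m)⁻¹ : ExtendedSL3 K).left =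
          m * g.left * g.right.1 m⁻¹ := by
      simp
    simp only [hleft, Matrix.SpecialLinearGroup.coe_mul, mul_apply, Finset.sum_mul]
    have hterm (r s : Fin 3) : (fun g : ExtendedSL3 K => m i s * g.left s r * g.right.1 m⁻¹ r j) ∈
        regularFunctions (coordinateRing k K) :=
      mul_mem (mul_mem ((regularFunctions _).algebraMap_mem (m i s)) (hentry s r))
        (comp_right_mem_regularFunctions fun t => t.1 m⁻¹ r j)
    convert sum_mem fun r (_ : r ∈ Finset.univ) =>
      sum_mem fun s (_ : s ∈ Finset.univ) => hterm r s using 1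
    ext g
    simp only [Finset.sum_apply]
  · simpa using comp_right_mem_regularFunctions f

theorem exists_hasLimitAtZero_mk_iff [Infinite K] {φ : Kˣ → SL(3, K)}
    {s : Subgroup.zpowers (graphAutomorphism K)} :
    (∃ x, HasLimitAtZero (coordinateRing k K) (fun a => ⟨φ a, s⟩) x) ↔
      ∀ i j, (fun a => φ a i j) ∈ polynomialUnitFunctions K := by
  refine ⟨fun ⟨x, hx⟩ i j => hx.comp_mem_polynomialUnitFunctions
    (mem_regularFunctions_of_mem (entry_mem_coordinateRing i j)), fun h => ?_⟩
  choose p hp using fun i j => mem_polynomialUnitFunctions.1 (h i j)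
  have hφ (a : Kˣ) : (Matrix.of p).map (Polynomial.eval (a : K)) = φ a := by
    ext i j
    exact hp i j a
  have hdet_eval (a : K) :
      ((Matrix.of p).map (Polynomial.eval a)).det = (Matrix.of p).det.eval a :=
    ((Polynomial.evalRingHom a).map_det (Matrix.of p)).symm
  have hdet : (Matrix.of p).det = 1 := eq_of_forall_eval_units_eq fun a => by
    rw [← hdet_eval, hφ, Matrix.SpecialLinearGroup.det_coe, Polynomial.eval_one]
  let ψ (a : K) : SL(3, K) :=
    ⟨(Matrix.of p).map (Polynomial.eval a), by rw [hdet_eval, hdet, Polynomial.eval_one]⟩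
  exact ⟨_, fun a => ⟨ψ a, s⟩,
    isMorphism_mk s fun i j => mem_regularFunctions_affineLine.2 ⟨p i j, fun _ => rfl⟩,
    fun a => SemidirectProduct.ext (Subtype.ext (hφ a)) rfl, rfl⟩

end CoordinateRing

section Cocharacters

open Matrix
open scoped MatrixGroups

variable {k K : Type*} [Field k] [Field K] [Algebra k K] [Infinite K]

theorem IsCocharacter.exists_eq_inl_comp {l : Kˣ →* ExtendedSL3 K}
    (hl : IsCocharacter (coordinateRing k K) l) :
    ∃ m : Kˣ →* SL(3, K), l = SemidirectProduct.inl.comp m := by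
  have hright (a : Kˣ) : (l a).right = 1 := by
    have hone := IsCocharacter.eq_one_of_finite_range (separatesPoints_coordinateRing k K)
      (l := SemidirectProduct.inr.comp (SemidirectProduct.rightHom.comp l))
      (isMorphism_inr_right.comp hl)
      ((Set.finite_range SemidirectProduct.inr).subset
        (Set.range_subset_iff.2 fun a => ⟨(l a).right, rfl⟩))
    exact congrArg SemidirectProduct.right (DFunLike.congr_fun hone a)
  refine ⟨⟨⟨fun a => (l a).left, by simp⟩, fun a b => by simp [hright]⟩, ?_⟩
  ext1 a
  exact SemidirectProduct.ext rfl (hright a)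

theorem IsCocharacter.eq_one_of_forall_mem_center {m : Kˣ →* SL(3, K)}
    (hm : IsCocharacter (coordinateRing k K) (SemidirectProduct.inl.comp m))
    (hcenter : ∀ a, m a ∈ Subgroup.center SL(3, K)) :
    (SemidirectProduct.inl.comp m : Kˣ →* ExtendedSL3 K) = 1 :=
  have := finite_center_specialLinearGroup (Fin 3) K
  hm.eq_one_of_finite_range (separatesPoints_coordinateRing k K)
    (((Set.toFinite (Subgroup.center SL(3, K) : Set SL(3, K))).image
      SemidirectProduct.inl).subset
        (Set.range_subset_iff.2 fun a => Set.mem_image_of_mem _ (hcenter a)))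

theorem not_isRParabolic_map_inl_top :
    ¬ IsRParabolic (coordinateRing k K)
      ((⊤ : Subgroup SL(3, K)).map SemidirectProduct.inl) := by
  rintro ⟨l, hl, hP⟩
  obtain ⟨m, rfl⟩ := hl.exists_eq_inl_comp
  have hcenter := mem_center_of_forall_conj_mem_polynomialUnitFunctions (m := m) fun g i j => by
    obtain ⟨x, hx⟩ := hP.subset (Subgroup.mem_map_of_mem SemidirectProduct.inl (Subgroup.mem_top g))
    simpa using hx.comp_mem_polynomialUnitFunctions
      (mem_regularFunctions_of_mem (entry_mem_coordinateRing i j))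
  rw [hl.eq_one_of_forall_mem_center hcenter, parabolicSet_one] at hP
  exact sigma_right_ne_one (mem_map_inl_iff.1 (hP.ge (Set.mem_univ (sigma K)))).1

theorem IsRLevi.eq_top_of_borelSubgroup_le {P L : Subgroup (ExtendedSL3 K)}
    (h : IsRLevi (coordinateRing k K) P L) (hL : borelSubgroup K ≤ L) : P = ⊤ := by
  obtain ⟨l, hl, hP, hL_eq⟩ := h
  obtain ⟨m, rfl⟩ := hl.exists_eq_inl_comp
  have hcommute (a : Kˣ) (b : SL(3, K)) (hb : b ∈ borelSL3 K) : Commute (m a) b := by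
    have hlevi : SemidirectProduct.inl b ∈
        leviSet (coordinateRing k K) (SemidirectProduct.inl.comp m) := by
      rw [← hL_eq]
      exact hL (Subgroup.mem_map_of_mem SemidirectProduct.inl hb)
    have hinl := (commute_of_mem_leviSet (separatesPoints_coordinateRing k K)
      (l := SemidirectProduct.inl.comp m) (fun a => isMorphism_conj_inl (m a)) hlevi a).eq
    rw [MonoidHom.comp_apply, ← map_mul, ← map_mul] at hinl
    exact SemidirectProduct.inl_injective hinl
  rw [hl.eq_one_of_forall_mem_center fun a => mem_center_of_forall_commute_borelSL3 (hcommute a),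
    parabolicSet_one] at hP
  exact SetLike.coe_injective hP

end Cocharacters

section FieldsOfDefinition

open Matrix
open scoped MatrixGroups

variable {α k K : Type*} [LinearOrder α] [Field k] [Field K] [Algebra k K]

theorem isZariskiClosed_setOf_right_mem_and_left_mem_flagStabilizer (b : Fin 3 → α)
    (T : Set (Subgroup.zpowers (graphAutomorphism K))) :
    IsZariskiClosed (coordinateRing k K)
      {g : ExtendedSL3 K | g.right ∈ T ∧ g.left ∈ flagStabilizer b} := by
  classical
  refine ⟨{f | ∃ s ∉ T, f = fun g => if g.right = s then 1 else 0} ∪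
    {f | ∃ i j, b j < b i ∧ f = fun g => g.left i j}, ?_, ?_⟩
  · rintro _ (⟨s, -, rfl⟩ | ⟨i, j, -, rfl⟩)
    · exact mem_regularFunctions_of_mem (indicator_right_mem_coordinateRing s)
    · exact mem_regularFunctions_of_mem (entry_mem_coordinateRing i j)
  · ext g
    constructor
    · rintro ⟨hright, hleft⟩ _ (⟨s, hs, rfl⟩ | ⟨i, j, hij, rfl⟩)
      · exact if_neg (ne_of_mem_of_not_mem hright hs)
      · exact hleft hij
    · intro h
      refine ⟨?_, fun i j hij => h _ (.inr ⟨i, j, hij, rfl⟩)⟩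
      by_contra hright
      simpa using h _ (.inl ⟨g.right, hright, rfl⟩)

variable [Infinite K]

theorem isLinearlyDisjointOn_setOf_right_mem_and_left_mem_flagStabilizer (b : Fin 3 → α)
    (T : Set (Subgroup.zpowers (graphAutomorphism K))) :
    IsLinearlyDisjointOn (coordinateRing k K)
      {g : ExtendedSL3 K | g.right ∈ T ∧ g.left ∈ flagStabilizer b} := by
  have hunion : {g : ExtendedSL3 K | g.right ∈ T ∧ g.left ∈ flagStabilizer b} =
      ⋃ s : T, Set.range fun x => ⟨flagStabilizerChart (k := k) b 0 x, s⟩ := by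
    ext g
    rw [Set.mem_iUnion]
    constructor
    · rintro ⟨hright, hleft⟩
      obtain ⟨x, hx⟩ := (range_flagStabilizerChart (k := k) b 0).ge hleft
      exact ⟨⟨g.right, hright⟩, x, SemidirectProduct.ext hx rfl⟩
    · rintro ⟨s, x, rfl⟩
      exact ⟨s.2, (range_flagStabilizerChart b 0).le ⟨x, rfl⟩⟩
  rw [hunion]
  exact IsLinearlyDisjointOn.iUnion fun s =>
    (isLinearlyDisjointOn_principalOpen (det_genericBlockTriangular_ne_zero b)).range fun _ hf =>
      comp_mk_mem_of_mem_coordinateRing _ (flagStabilizerChart_apply_mem_principalOpen b 0) hf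

theorem isDefinedOver_map_inl_flagStabilizer (b : Fin 3 → α) :
    IsDefinedOver (coordinateRing k K)
      (((flagStabilizer b).map SemidirectProduct.inl : Subgroup (ExtendedSL3 K)) :
        Set (ExtendedSL3 K)) := by
  have hset : (((flagStabilizer b).map SemidirectProduct.inl : Subgroup (ExtendedSL3 K)) :
      Set (ExtendedSL3 K)) = {g | g.right ∈ ({1} : Set _) ∧ g.left ∈ flagStabilizer b} :=
    Set.ext fun _ => mem_map_inl_iff
  rw [hset]
  exact (isLinearlyDisjointOn_setOf_right_mem_and_left_mem_flagStabilizer b {1}).isDefinedOver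
    (isZariskiClosed_setOf_right_mem_and_left_mem_flagStabilizer b {1})

theorem isDefinedOver_extendedBorel :
    IsDefinedOver (coordinateRing k K) (extendedBorel K : Set (ExtendedSL3 K)) := by
  have hset : (extendedBorel K : Set (ExtendedSL3 K)) =
      {g | g.right ∈ Set.univ ∧ g.left ∈ flagStabilizer id} :=
    Set.ext fun _ => (and_iff_right trivial).symm
  rw [hset]
  exact (isLinearlyDisjointOn_setOf_right_mem_and_left_mem_flagStabilizer id _).isDefinedOver
    (isZariskiClosed_setOf_right_mem_and_left_mem_flagStabilizer id _)

end FieldsOfDefinition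

section Parabolics

open Matrix
open scoped MatrixGroups

variable {α k K : Type*} [LinearOrder α] [Field k] [Field K] [Algebra k K] {n : Fin 3 → ℤ}

theorem isCocharacter_inl_comp_diagonalCocharacter (hn : ∑ i, n i = 0) :
    IsCocharacter (coordinateRing k K)
      (SemidirectProduct.inl.comp (diagonalCocharacter K n hn)) := by
  refine isMorphism_mk 1 fun i j => ?_
  rcases eq_or_ne i j with rfl | hij
  · simpa only [coe_diagonalCocharacter, diagonal_apply_eq] using
      zpow_mem_regularFunctions_multiplicativeGroup (n i)
  · simp only [coe_diagonalCocharacter, diagonal_apply_ne _ hij]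
    exact zero_mem _

theorem sum_neg_rev_eq_zero (hn : ∑ i, n i = 0) : ∑ i : Fin 3, -n i.rev = 0 := by
  rw [Finset.sum_neg_distrib, neg_eq_zero, ← hn]
  exact Equiv.sum_comp Fin.revPerm n

theorem graphAutomorphism_diagonalCocharacter (hn : ∑ i, n i = 0) (a : Kˣ) :
    graphAutomorphism K (diagonalCocharacter K n hn a) =
      diagonalCocharacter K (fun i => -n i.rev) (sum_neg_rev_eq_zero hn) a := by
  ext i j
  rw [graphAutomorphism_apply_apply, ← map_inv, coe_diagonalCocharacter, coe_diagonalCocharacter]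
  rcases eq_or_ne i j with rfl | hij
  · simp [← two_mul]
  · simp [hij, (Fin.rev_injective.ne hij).symm]

variable [Infinite K]

theorem mem_parabolicSet_diagonalCocharacter_iff {n' : Fin 3 → ℤ} (hn : ∑ i, n i = 0)
    (hn' : ∑ i, n' i = 0) {g : ExtendedSL3 K}
    (h : ∀ a, g.right.1 (diagonalCocharacter K n hn a) = diagonalCocharacter K n' hn' a) :
    g ∈ parabolicSet (coordinateRing k K)
        (SemidirectProduct.inl.comp (diagonalCocharacter K n hn)) ↔
      ∀ i j, n i < n' j → g.left i j = 0 := by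
  have hconj (a : Kˣ) :
      SemidirectProduct.inl (diagonalCocharacter K n hn a) * g *
        (SemidirectProduct.inl (diagonalCocharacter K n hn a))⁻¹ =
      ⟨diagonalCocharacter K n hn a * g.left * (diagonalCocharacter K n' hn' a)⁻¹, g.right⟩ := by
    rw [← h]
    ext <;> simp
  rw [parabolicSet, Set.mem_ofPred_eq]
  simp only [MonoidHom.comp_apply, hconj]
  refine exists_hasLimitAtZero_mk_iff.trans (forall₂_congr fun i j => ?_)
  simp only [diagonalCocharacter_mul_mul_inv_apply]
  rw [zpow_mul_const_mem_polynomialUnitFunctions_iff, sub_nonneg, ← not_lt, imp_iff_not_or]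

theorem isRParabolic_map_inl_flagStabilizer {b : Fin 3 → α} (hn : ∑ i, n i = 0)
    (hb : ∀ i j, b j < b i ↔ n i < n j) (hn_neg : ∃ i, ∀ j, n j ≠ -n i) :
    IsRParabolic (coordinateRing k K)
      ((flagStabilizer b).map (SemidirectProduct.inl : SL(3, K) →* ExtendedSL3 K)) := by
  refine ⟨_, isCocharacter_inl_comp_diagonalCocharacter hn, Set.ext fun g => ?_⟩
  refine mem_map_inl_iff.trans ?_
  rcases eq_one_or_eq_sigma_right g.right with hright | hright
  · rw [mem_parabolicSet_diagonalCocharacter_iff hn hn fun a => by rw [hright]; rfl]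
    simp only [hright, mem_flagStabilizer_iff, hb, true_and]
  · rw [mem_parabolicSet_diagonalCocharacter_iff hn (sum_neg_rev_eq_zero hn) fun a => by
      rw [hright]; exact graphAutomorphism_diagonalCocharacter hn a]
    refine iff_of_false (fun h => sigma_right_ne_one (hright ▸ h.1)) fun hzero => ?_
    have hdet : (g.left : Matrix (Fin 3) (Fin 3) K).det ≠ 0 := by simp
    obtain ⟨τ, hτ⟩ := exists_perm_comp_eq_of_det_ne_zero hdet hzero
      (hn.trans (sum_neg_rev_eq_zero hn).symm)
    obtain ⟨i, hi⟩ := hn_neg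
    exact hi (τ i.rev) (by simpa using congrFun hτ i.rev)

theorem isRParabolic_borelSubgroup : IsRParabolic (coordinateRing k K) (borelSubgroup K) :=
  isRParabolic_map_inl_flagStabilizer (n := ![3, -1, -2]) (by decide) (by decide) (by decide)

theorem isRParabolic_map_inl_lineStabilizer :
    IsRParabolic (coordinateRing k K)
      ((lineStabilizer K).map (SemidirectProduct.inl : SL(3, K) →* ExtendedSL3 K)) :=
  isRParabolic_map_inl_flagStabilizer (n := ![2, -1, -1]) (by decide) (by decide) (by decide)

theorem isRParabolic_map_inl_planeStabilizer :
    IsRParabolic (coordinateRing k K)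
      ((planeStabilizer K).map (SemidirectProduct.inl : SL(3, K) →* ExtendedSL3 K)) :=
  isRParabolic_map_inl_flagStabilizer (n := ![1, 1, -2]) (by decide) (by decide) (by decide)

theorem isRParabolic_extendedBorel : IsRParabolic (coordinateRing k K) (extendedBorel K) := by
  have hn : ∑ i, (![1, 0, -1] : Fin 3 → ℤ) i = 0 := by decide
  have hb : ∀ i j : Fin 3, j < i ↔ (![1, 0, -1] : Fin 3 → ℤ) i < (![1, 0, -1] : Fin 3 → ℤ) j := by
    decide
  have hneg : (fun i : Fin 3 => -(![1, 0, -1] : Fin 3 → ℤ) i.rev) = ![1, 0, -1] := by decide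
  refine ⟨_, isCocharacter_inl_comp_diagonalCocharacter hn, Set.ext fun g => ?_⟩
  rw [mem_parabolicSet_diagonalCocharacter_iff hn hn fun a => ?_]
  · exact forall₂_congr fun i j => imp_congr_left (hb i j)
  · rcases eq_one_or_eq_sigma_right g.right with hright | hright <;> rw [hright]
    · rfl
    · refine (graphAutomorphism_diagonalCocharacter hn a).trans ?_
      congr 1
      simp only [hneg]

end Parabolics

section SimplicialComplexes

theorem IsSimplicialComplex.exists_card_Iic_eq_two_pow {X : Type*} [PartialOrder X]
    (hX : IsSimplicialComplex X) (a : X) [Finite (Set.Iic a)] :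
    ∃ n, Nat.card (Set.Iic a) = 2 ^ n := by
  obtain ⟨V, ⟨e⟩⟩ := hX.1 a
  have : Finite (Set V) := Finite.of_equiv _ e.toEquiv
  have : Finite V := Finite.of_injective (singleton : V → Set V) Set.singleton_injective
  have := Fintype.ofFinite V
  exact ⟨Fintype.card V, by rw [Nat.card_congr e.toEquiv, Nat.card_eq_fintype_card,
    Fintype.card_set]⟩

/-- For the ordering by reversed inclusion, the faces of an R-parabolic subgroup are the R-parabolic
subgroups that contain it. -/
def iicToDualEquivKRParabolicsOver {k K Γ : Type*} [Field k] [Field K] [Algebra k K] [Group Γ]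
    {A : Subalgebra k (Γ → K)} (P : kRParabolics A) :
    Set.Iic (OrderDual.toDual P) ≃ kRParabolicsOver A P.1 where
  toFun Q := ⟨(OrderDual.ofDual Q.1).1, (OrderDual.ofDual Q.1).2, Q.2⟩
  invFun Q := ⟨OrderDual.toDual ⟨Q.1, Q.2.1⟩, Q.2.2⟩

end SimplicialComplexes

section MainTheorem

open Matrix
open scoped MatrixGroups

variable {k K : Type*} [Field k] [Field K] [Algebra k K]

theorem ne_map_inl_of_sigma_mem {P : Subgroup (ExtendedSL3 K)} (hP : sigma K ∈ P)
    (Q : Subgroup SL(3, K)) : P ≠ Q.map SemidirectProduct.inl := by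
  rintro rfl
  exact sigma_right_ne_one (mem_map_inl_iff.1 hP).1

theorem notMem_building_of_sigma_mem {P : Subgroup (ExtendedSL3 K)} (hP : sigma K ∈ P) :
    P ∉ building k K :=
  fun ⟨Q, _, _, hQ⟩ => ne_map_inl_of_sigma_mem hP Q hQ

theorem extendedBorel_ne_top : extendedBorel K ≠ ⊤ := by
  intro h
  have hij : (1 : Fin 3) ≠ 0 := by decide
  have ht : Matrix.SpecialLinearGroup.transvection hij (1 : K) ∈ flagStabilizer id :=
    mem_extendedBorel_iff.1 (h.ge (Subgroup.mem_top (SemidirectProduct.inl _)))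
  exact absurd ((transvection_mem_flagStabilizer_iff hij).1 ht) (by decide)

theorem lineStabilizer_ne_borelSL3 : lineStabilizer K ≠ borelSL3 K :=
  flagStabilizer_ne_flagStabilizer (i := 2) (j := 1) (c := id) (by decide) (by decide)

theorem planeStabilizer_ne_borelSL3 : planeStabilizer K ≠ borelSL3 K :=
  flagStabilizer_ne_flagStabilizer (i := 1) (j := 0) (c := id) (by decide) (by decide)

theorem lineStabilizer_ne_planeStabilizer : lineStabilizer K ≠ planeStabilizer K := by
  intro h
  have hborel := lineStabilizer_inf_planeStabilizer (K := K)
  rw [h, inf_idem] at hborel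
  exact planeStabilizer_ne_borelSL3 hborel

variable [Infinite K]

theorem extendedBorel_mem_kRParabolics : extendedBorel K ∈ kRParabolics (coordinateRing k K) :=
  ⟨isRParabolic_extendedBorel, isDefinedOver_extendedBorel⟩

theorem borelSubgroup_mem_kRParabolics : borelSubgroup K ∈ kRParabolics (coordinateRing k K) :=
  ⟨isRParabolic_borelSubgroup, isDefinedOver_map_inl_flagStabilizer id⟩

theorem kRParabolicsOver_borelSubgroup :
    kRParabolicsOver (coordinateRing k K) (borelSubgroup K) =
      {⊤, extendedBorel K, (lineStabilizer K).map SemidirectProduct.inl,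
        (planeStabilizer K).map SemidirectProduct.inl, borelSubgroup K} := by
  ext P
  constructor
  · rintro ⟨⟨hP, -⟩, hB⟩
    rcases eq_of_borelSubgroup_le hB with rfl | rfl | rfl | rfl | rfl | rfl
    on_goal 5 => exact absurd hP not_isRParabolic_map_inl_top
    all_goals simp
  · rintro (rfl | rfl | rfl | rfl | rfl)
    · exact ⟨⟨isRParabolic_top, isDefinedOver_univ _⟩, le_top⟩
    · exact ⟨extendedBorel_mem_kRParabolics, borelSubgroup_le_extendedBorel⟩
    · exact ⟨⟨isRParabolic_map_inl_lineStabilizer, isDefinedOver_map_inl_flagStabilizer _⟩,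
        Subgroup.map_mono borelSL3_le_lineStabilizer⟩
    · exact ⟨⟨isRParabolic_map_inl_planeStabilizer, isDefinedOver_map_inl_flagStabilizer _⟩,
        Subgroup.map_mono borelSL3_le_planeStabilizer⟩
    · exact ⟨borelSubgroup_mem_kRParabolics, le_rfl⟩

theorem ncard_kRParabolicsOver_borelSubgroup :
    (kRParabolicsOver (coordinateRing k K) (borelSubgroup K)).ncard = 5 := by
  have hinj := Subgroup.map_injective
    (SemidirectProduct.inl_injective : Function.Injective (SemidirectProduct.inl :
      SL(3, K) →* ExtendedSL3 K))
  rw [kRParabolicsOver_borelSubgroup, Set.ncard_insert_of_notMem, Set.ncard_insert_of_notMem,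
    Set.ncard_insert_of_notMem, Set.ncard_pair]
  · exact hinj.ne planeStabilizer_ne_borelSL3
  · rintro (h | h)
    exacts [lineStabilizer_ne_planeStabilizer (hinj h), lineStabilizer_ne_borelSL3 (hinj h)]
  · rintro (h | h | h) <;> exact ne_map_inl_of_sigma_mem sigma_mem_extendedBorel _ h
  · rintro (h | h | h | h)
    · exact extendedBorel_ne_top h.symm
    all_goals exact ne_map_inl_of_sigma_mem (Subgroup.mem_top _) _ h

theorem not_isCompletelyReducibleOver_extendedBorel :
    ¬ IsCompletelyReducibleOver (coordinateRing k K) (extendedBorel K) := by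
  intro h
  obtain ⟨L, hL, -, hle⟩ := h _ extendedBorel_mem_kRParabolics le_rfl
  exact extendedBorel_ne_top
    (hL.eq_top_of_borelSubgroup_le (borelSubgroup_le_extendedBorel.trans hle))

theorem not_isSimplicialComplex_kRParabolics :
    ¬ IsSimplicialComplex (kRParabolics (coordinateRing k K))ᵒᵈ := by
  intro h
  let B : kRParabolics (coordinateRing k K) := ⟨borelSubgroup K, borelSubgroup_mem_kRParabolics⟩
  have hcard : Nat.card (Set.Iic (OrderDual.toDual B)) = 5 := by
    rw [Nat.card_congr (iicToDualEquivKRParabolicsOver B), Nat.card_coe_set_eq]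
    exact ncard_kRParabolicsOver_borelSubgroup
  have : Finite (Set.Iic (OrderDual.toDual B)) := Nat.finite_of_card_ne_zero (by lia)
  obtain ⟨n, hn⟩ := h.exists_card_Iic_eq_two_pow (OrderDual.toDual B)
  rw [hcard] at hn
  have hn_two := (Nat.prime_dvd_prime_iff_eq Nat.prime_five Nat.prime_two).1
    (Nat.prime_five.dvd_of_dvd_pow hn.dvd)
  exact absurd hn_two (by decide)

theorem mainTheorem4_general (k K : Type*) [Field k] [Field K] [Algebra k K] [Infinite K] :
    (∃ H : Subgroup (ExtendedSL3 K),
      H = Subgroup.closure (insert (sigma K) (borelSubgroup K : Set (ExtendedSL3 K))) ∧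
      IsDefinedOver (coordinateRing k K) (H : Set (ExtendedSL3 K)) ∧
      ¬ IsCompletelyReducibleOver (coordinateRing k K) H ∧
      ¬ (kRParabolicsOver (coordinateRing k K) H ⊆ building k K) ∧
      ¬ (kRParabolicsOver (coordinateRing k K) H \ {⊤} ⊆ building k K)) ∧
    (kRParabolicsOver (coordinateRing k K) (borelSubgroup K)).ncard = 5 ∧
    ¬ IsSimplicialComplex (kRParabolics (coordinateRing k K))ᵒᵈ := by
  have hmem : extendedBorel K ∈ kRParabolicsOver (coordinateRing k K) (extendedBorel K) \ {⊤} :=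
    ⟨⟨extendedBorel_mem_kRParabolics, le_rfl⟩, extendedBorel_ne_top⟩
  have hbuilding : extendedBorel K ∉ building k K :=
    notMem_building_of_sigma_mem sigma_mem_extendedBorel
  exact ⟨⟨extendedBorel K, extendedBorel_eq_closure, isDefinedOver_extendedBorel,
    not_isCompletelyReducibleOver_extendedBorel, fun h => hbuilding (h hmem.1),
    fun h => hbuilding (h hmem)⟩, ncard_kRParabolicsOver_borelSubgroup,
    not_isSimplicialComplex_kRParabolics⟩

end MainTheorem

theorem mainTheorem4 (k K : Type*) [Field k] [Field K] [Algebra k K] [IsAlgClosure k K] :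
    (∃ H : Subgroup (ExtendedSL3 K),
      H = Subgroup.closure (insert (sigma K) (borelSubgroup K : Set (ExtendedSL3 K))) ∧
      IsDefinedOver (coordinateRing k K) (H : Set (ExtendedSL3 K)) ∧
      ¬ IsCompletelyReducibleOver (coordinateRing k K) H ∧
      ¬ (kRParabolicsOver (coordinateRing k K) H ⊆ building k K) ∧
      ¬ (kRParabolicsOver (coordinateRing k K) H \ {⊤} ⊆ building k K)) ∧
    (kRParabolicsOver (coordinateRing k K) (borelSubgroup K)).ncard = 5 ∧
    ¬ IsSimplicialComplex (kRParabolics (coordinateRing k K))ᵒᵈ := by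
  have := IsAlgClosure.isAlgClosed (K := K) k
  exact mainTheorem4_general k K
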